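/- A convex body in $\mathbb{R}^2$ is a compact convex set with non-empty interior; it is symmetric if it has a center of symmetry. For convex bodies $K,L\subseteq\mathbb{R}^2$ let $$d_{BM}(K,L)=\inf\{r>0:\ K+u\subseteq T(L+v)\subseteq r(K+u)\ \text{for some invertible linear } T:\mathbb{R}^2\to\mathbb{R}^2 \text{ and } u,v\in\mathbb{R}^2\},$$ $$\mathrm{as}(K)=\inf\{r>0:\ K-z\subseteq -r(K-z)\ \text{for some } z\in\operatorname{int}K\}.$$ A convex pentagon is the convex hull of five points, none of which lies in the convex hull of the other four. (1) For every $\frac74\le r<2$ there is a convex pentagon $K\subseteq\mathbb{R}^2$ such that $d_{BM}(K,L)=\mathrm{as}(K)=r$ for every symmetric convex body $L\subseteq\mathbb{R}^2$. For $r=2$ there is a (non-degenerate) triangle $K$ with this property. (2) For every $\frac74<r<2$ there are continuum many pairwise affinely non-equivalent convex pentagons $K$ with the property in (1). (3) If $K\subseteq\mathbb{R}^2$ is a convex body and $r$ is a real number such that $d_{BM}(K,L)=r$ for every symmetric convex body $L\subseteq\mathbb{R}^2$, then $r\ge\sqrt{3/2}$, $K$ is not smooth (some boundary point of $K$ has more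 than one supporting line) and $K$ is not strictly convex. -/

import Mathlib

open scoped Pointwise

noncomputable section

/-- The Euclidean plane. -/
abbrev Plane : Type := EuclideanSpace ℝ (Fin 2)

/-- A convex body: a compact convex set with non-empty interior. -/
def IsConvexBody (K : Set Plane) : Prop :=
  Convex ℝ K ∧ IsCompact K ∧ (interior K).Nonempty

/-- A set is (centrally) symmetric if it has a center of symmetry `c`, which may be any point. -/
def IsCentrallySymmetric (L : Set Plane) : Prop :=
  ∃ c : Plane, ∀ x ∈ L, (2 : ℝ) • c - x ∈ L

/-- The Banach-Mazur distance: the infimum of all `r > 0` such that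
`K + u ⊆ T (L + v) ⊆ r (K + u)` for some invertible linear `T` and some vectors `u`, `v`. -/
def banachMazurDist (K L : Set Plane) : ℝ :=
  sInf {r : ℝ | 0 < r ∧ ∃ (T : Plane ≃ₗ[ℝ] Plane) (u v : Plane),
    u +ᵥ K ⊆ T '' (v +ᵥ L) ∧ T '' (v +ᵥ L) ⊆ r • (u +ᵥ K)}

/-- The asymmetry constant: the infimum of all `r > 0` such that
`K - z ⊆ -r (K - z)` for some interior point `z` of `K`. -/
def asymmetryConst (K : Set Plane) : ℝ :=
  sInf {r : ℝ | 0 < r ∧ ∃ z ∈ interior K, (-z) +ᵥ K ⊆ (-r) • ((-z) +ᵥ K)}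

/-- A convex pentagon: the convex hull of five points, none of which
lies in the convex hull of the other four. -/
def IsConvexPentagon (K : Set Plane) : Prop :=
  ∃ p : Fin 5 → Plane, ConvexIndependent ℝ p ∧ K = convexHull ℝ (Set.range p)

/-- A (non-degenerate) triangle. -/
def IsTriangle (K : Set Plane) : Prop :=
  ∃ p : Fin 3 → Plane, AffineIndependent ℝ p ∧ K = convexHull ℝ (Set.range p)

/-- Two sets are affinely equivalent if an invertible affine map takes one onto the other. -/
def AffinelyEquivalent (K K' : Set Plane) : Prop :=
  ∃ f : Plane ≃ᵃ[ℝ] Plane, f '' K = K'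

/-- `ℓ` is a line through `x` such that `K` lies in one of the two closed half-planes
bounded by `ℓ`. -/
def IsSupportingLineAt (K : Set Plane) (x : Plane) (ℓ : Set Plane) : Prop :=
  ∃ v : Plane, v ≠ 0 ∧ ℓ = {y | inner ℝ v y = inner ℝ v x} ∧ ∀ y ∈ K, inner ℝ v y ≤ inner ℝ v x

/-- A convex body is smooth if it has exactly one supporting line at each boundary point. -/
def IsSmoothBody (K : Set Plane) : Prop :=
  ∀ x ∈ frontier K, ∃! ℓ : Set Plane, IsSupportingLineAt K x ℓ

/-- `K` has Banach-Mazur distance `r` to every symmetric convex body of the plane. -/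
def EquidistantToSymmetric (K : Set Plane) (r : ℝ) : Prop :=
  ∀ L : Set Plane, IsConvexBody L → IsCentrallySymmetric L → banachMazurDist K L = r

end

/-!
Throughout, a Banach-Mazur estimate is a sandwich `K ⊆ L' ⊆ r K + w` with an affine copy `L'` of
`L` (`HasAffineSandwich`). Reflecting `L'` in its center turns this into `K ⊆ -r K + c`, so the
distance of `K` to a symmetric body is never below the asymmetry constant.

*Pentagons and the triangle.* A triangle of maximal area in a symmetric body `L` may be moved to
`(0,0)`, `(1,0)`, `(0,1)`; then `L` lies in the triangle `x ≤ 1`, `y ≤ 1`, `x + y ≥ 0`. The center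
`m` of `L` has three barycentric coordinates with sum `1`; labelling the vertices such that the one
of `(0,0)` is the smallest, the others are at least `1/4`, and symmetry gives `x, y ≥ -1/2` on `L`
as well as `2m ∈ L`. The additional vertices of `pentagon s τ`, on the line `x + y = s`, are chosen
in the triangle `(1,0)`, `(0,1)`, `2m` for all such `m` (this needs `τ ≥ 2 (s - 1)`), while the
pentagon is still large enough for `L ⊆ -(2/s) K + (1,1)` (this needs `τ ≤ s / 4`). Hence the
distance is `r = 2 / s` for every `L`; admissible `τ` exist iff `r ≥ 7/4`, and form a proper interval
if `r > 7/4`. The sum of the squared areas of all triangles of vertices, normalized by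
the area of the largest such triangle, is an affine invariant that determines `τ`
(`PentagonParam.eq_of_affinelyEquivalent`).

*Necessary conditions.* Let `K` have distance `r` to all symmetric bodies. The square and the
regular hexagon have distance at least `3/2` (`three_halves_le_mul`), whence `r² ≥ 3/2`. Comparing
`K` with `(K - z) ∩ (z - K)` shows that `K ⊆ -t K + c` is impossible for `1 < t < r`
(`EquidistantToSymmetric.le_of_isAsymmetryBound`). The distance to the square `P` is attained, so
after an affine map `K ⊆ P ⊆ -r K + c`, where no translate of `K` fits into the interior of
`-r K + c`. If `K` contained no vertex of `P`, it could be moved away from the sides at which it is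
blocked, as two opposite sides cannot both be blocking when `r > 1`; so `K` has a corner at a vertex
of `P` (`OptimalSquarePosition.exists_vertex`). Similarly, either `K` contains a side of `P` or
a side of `P` lies on the boundary of `-r K + c`; in both cases `K` has a segment on its
boundary (`OptimalSquarePosition.exists_adjacent_or_side`).
-/

open scoped Pointwise
open Filter Topology

/-! ### Sandwiches and asymmetry -/

/-- An affine copy of `L` lies between `K` and a translate of `r • K`; the affine copy is written
as the preimage of `L` under `x ↦ h x + p`. -/
def HasAffineSandwich (K L : Set Plane) (r : ℝ) : Prop :=
  ∃ (h : Plane ≃ₗ[ℝ] Plane) (p w : Plane),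
    (∀ k ∈ K, h k + p ∈ L) ∧ ∀ y ∈ L, ∃ k ∈ K, y = h (r • k + w) + p

/-- `K` lies in a translate of `-t • K`, where `t > 0`. -/
def IsAsymmetryBound (K : Set Plane) (t : ℝ) : Prop :=
  0 < t ∧ ∃ c : Plane, ∀ x ∈ K, ∃ y ∈ K, x = -(t • y) + c

/-- The set whose infimum is the Banach-Mazur distance. -/
def banachMazurSet (K L : Set Plane) : Set ℝ :=
  {r : ℝ | 0 < r ∧ ∃ (T : Plane ≃ₗ[ℝ] Plane) (u v : Plane),
    u +ᵥ K ⊆ T '' (v +ᵥ L) ∧ T '' (v +ᵥ L) ⊆ r • (u +ᵥ K)}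

theorem banachMazurDist_eq_sInf (K L : Set Plane) :
    banachMazurDist K L = sInf (banachMazurSet K L) := rfl

theorem hasAffineSandwich_of_mem {K L : Set Plane} {r : ℝ} (hr : r ∈ banachMazurSet K L) :
    HasAffineSandwich K L r := by
  obtain ⟨-, T, u, v, h1, h2⟩ := hr
  refine ⟨T.symm, T.symm u - v, (r - 1) • u, fun k hk => ?_, fun y hy => ?_⟩
  · obtain ⟨z, ⟨y, hy, rfl⟩, hz⟩ := h1 (Set.vadd_mem_vadd_set (a := u) hk)
    have : T.symm k + (T.symm u - v) = y := by
      have h3 : v + y = T.symm (u + k) := by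
        rw [← T.symm_apply_apply (v + y)]; exact congrArg _ hz
      rw [map_add] at h3
      linear_combination (norm := module) -h3
    rwa [this]
  · obtain ⟨z, ⟨k, hk, rfl⟩, hz⟩ := h2 ⟨v + y, ⟨y, hy, rfl⟩, rfl⟩
    refine ⟨k, hk, ?_⟩
    have h3 : v + y = T.symm (r • (u + k)) := by
      rw [← T.symm_apply_apply (v + y)]; exact congrArg _ hz.symm
    have h4 : r • k + (r - 1) • u = r • (u + k) - u := by module
    rw [h4, map_sub, ← h3]; abel

theorem mem_banachMazurSet {K L : Set Plane} {r : ℝ} (hr : 1 < r)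
    (hs : HasAffineSandwich K L r) : r ∈ banachMazurSet K L := by
  obtain ⟨h, p, w, h1, h2⟩ := hs
  have hr' : r - 1 ≠ 0 := by linarith
  set u : Plane := (r - 1)⁻¹ • w with hu
  have hw : w = r • u - u := by
    rw [hu]
    have : r • (r - 1)⁻¹ • w - (r - 1)⁻¹ • w = ((r - 1) * (r - 1)⁻¹) • w := by module
    rw [this, mul_inv_cancel₀ hr', one_smul]
  refine ⟨by linarith, h.symm, u, h u - p, ?_, ?_⟩
  · rintro _ ⟨k, hk, rfl⟩
    refine ⟨h u - p + (h k + p), ⟨_, h1 k hk, rfl⟩, ?_⟩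
    have : h u - p + (h k + p) = h (u + k) := by rw [map_add]; abel
    rw [this, LinearEquiv.symm_apply_apply]; rfl
  · rintro _ ⟨_, ⟨y, hy, rfl⟩, rfl⟩
    obtain ⟨k, hk, rfl⟩ := h2 y hy
    refine ⟨u + k, ⟨k, hk, rfl⟩, ?_⟩
    have : (h u - p) +ᵥ (h (r • k + w) + p) = h (r • (u + k)) := by
      rw [vadd_eq_add, add_comm (h _) p, ← add_assoc, sub_add_cancel, ← map_add, hw]
      congr 1; module
    simp only [this, LinearEquiv.symm_apply_apply]

theorem bddBelow_banachMazurSet (K L : Set Plane) : BddBelow (banachMazurSet K L) :=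
  ⟨0, fun _ h => h.1.le⟩

theorem banachMazurDist_le {K L : Set Plane} {r : ℝ} (hr : 1 < r)
    (hs : HasAffineSandwich K L r) : banachMazurDist K L ≤ r :=
  csInf_le (bddBelow_banachMazurSet K L) (mem_banachMazurSet hr hs)

/-- Reflecting the inner body of a sandwich in the center of `L`. -/
theorem HasAffineSandwich.isAsymmetryBound {K L : Set Plane} {r : ℝ}
    (hL : IsCentrallySymmetric L) (hr : 0 < r) (hs : HasAffineSandwich K L r) :
    IsAsymmetryBound K r := by
  obtain ⟨h, p, w, h1, h2⟩ := hs
  obtain ⟨c, hc⟩ := hL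
  refine ⟨hr, h.symm ((2 : ℝ) • c - p - p) - w, fun x hx => ?_⟩
  obtain ⟨y, hy, hxy⟩ := h2 _ (hc _ (h1 x hx))
  refine ⟨y, hy, h.injective ?_⟩
  rw [map_add, map_neg, map_sub, LinearEquiv.apply_symm_apply]
  rw [map_add] at hxy
  linear_combination (norm := module) -hxy

/-- If `K - z ⊆ -t (K - z)` with `t > 0`, then `z` is automatically interior to `K`. -/
theorem mem_interior_of_asymmetry {K : Set Plane} (hK : Convex ℝ K) (hi : (interior K).Nonempty)
    {t : ℝ} (ht : 0 < t) {c : Plane} (hc : ∀ x ∈ K, ∃ y ∈ K, x = -(t • y) + c) :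
    (1 + t)⁻¹ • c ∈ interior K := by
  obtain ⟨x, hx⟩ := hi
  obtain ⟨y, hy, hxy⟩ := hc x (interior_subset hx)
  have h1 : (1 + t) ≠ 0 := by positivity
  have h2 : (1 + t)⁻¹ • c = (1 + t)⁻¹ • x + (t / (1 + t)) • y := by
    rw [hxy, div_eq_inv_mul, mul_smul]; module
  rw [h2]
  exact hK.combo_interior_self_mem_interior hx hy (by positivity) (by positivity) (by field_simp)

/-- The asymmetry constant, computed without reference to interior points. -/
theorem asymmetryConst_eq {K : Set Plane} (hK : Convex ℝ K) (hi : (interior K).Nonempty)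
    {r : ℝ} (hb : IsAsymmetryBound K r) (hmin : ∀ t, IsAsymmetryBound K t → r ≤ t) :
    asymmetryConst K = r := by
  have key : r ∈ {r : ℝ | 0 < r ∧ ∃ z ∈ interior K, (-z) +ᵥ K ⊆ (-r) • ((-z) +ᵥ K)} := by
    obtain ⟨hr, c, hc⟩ := hb
    refine ⟨hr, _, mem_interior_of_asymmetry hK hi hr hc, ?_⟩
    rintro _ ⟨x, hx, rfl⟩
    obtain ⟨y, hy, rfl⟩ := hc x hx
    refine ⟨_, ⟨y, hy, rfl⟩, ?_⟩
    have h1 : (1 + r) ≠ 0 := by positivity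
    have h2 : c = (1 + r)⁻¹ • c + r • (1 + r)⁻¹ • c := by
      rw [smul_smul, ← add_smul]
      rw [show (1 + r)⁻¹ + r * (1 + r)⁻¹ = 1 by field_simp, one_smul]
    simp only [vadd_eq_add]
    generalize (1 + r)⁻¹ • c = z at h2 ⊢
    rw [h2]; module
  refine le_antisymm (csInf_le ⟨0, fun _ h => h.1.le⟩ key) (le_csInf ⟨_, key⟩ ?_)
  rintro t ⟨ht, z, -, h⟩
  refine hmin t ⟨ht, z + t • z, fun x hx => ?_⟩
  obtain ⟨_, ⟨y, hy, rfl⟩, hxy⟩ := h (Set.vadd_mem_vadd_set (a := -z) hx)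
  refine ⟨y, hy, ?_⟩
  simp only [vadd_eq_add] at hxy
  linear_combination (norm := module) -hxy

/-- A body with asymmetry constant `r` that admits a sandwich of ratio `r` around every symmetric
body is equidistant to the symmetric bodies. -/
theorem equidistantToSymmetric_of_sandwich {K : Set Plane} {r : ℝ} (hr : 1 < r)
    (hmin : ∀ t, IsAsymmetryBound K t → r ≤ t)
    (hs : ∀ L, IsConvexBody L → IsCentrallySymmetric L → HasAffineSandwich K L r) :
    EquidistantToSymmetric K r := by
  intro L hL hLs
  refine le_antisymm (banachMazurDist_le hr (hs L hL hLs)) ?_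
  refine le_csInf ⟨_, mem_banachMazurSet hr (hs L hL hLs)⟩ fun t ht => ?_
  exact hmin t ((hasAffineSandwich_of_mem ht).isAsymmetryBound hLs ht.1)

/-! ### Triangles of maximal area -/

/-- Twice the signed area of the triangle `a`, `b`, `c`. -/
def triDet (a b c : Plane) : ℝ := (b 0 - a 0) * (c 1 - a 1) - (b 1 - a 1) * (c 0 - a 0)

/-- The linear automorphism of the plane with prescribed linearly independent columns. -/
theorem exists_linearEquiv_columns (u v : Plane) (hd : u 0 * v 1 - u 1 * v 0 ≠ 0) :
    ∃ h : Plane ≃ₗ[ℝ] Plane, ∀ x, h x = x 0 • u + x 1 • v := by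
  let f : Plane →ₗ[ℝ] Plane :=
    { toFun := fun x => x 0 • u + x 1 • v
      map_add' := fun x y => by simp only [PiLp.add_apply]; module
      map_smul' := fun c x => by simp only [PiLp.smul_apply, smul_eq_mul, RingHom.id_apply]; module }
  have hf : Function.Injective f := by
    rw [← LinearMap.ker_eq_bot, LinearMap.ker_eq_bot']
    intro x hx
    have h0 : x 0 * u 0 + x 1 * v 0 = 0 := by simpa [f] using congrArg (fun y : Plane => y 0) hx
    have h1 : x 0 * u 1 + x 1 * v 1 = 0 := by simpa [f] using congrArg (fun y : Plane => y 1) hx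
    ext i
    fin_cases i
    · refine (mul_eq_zero.mp (?_ : x 0 * (u 0 * v 1 - u 1 * v 0) = 0)).resolve_right hd
      linear_combination v 1 * h0 - v 0 * h1
    · refine (mul_eq_zero.mp (?_ : x 1 * (u 0 * v 1 - u 1 * v 0) = 0)).resolve_right hd
      linear_combination u 0 * h1 - u 1 * h0
  exact ⟨LinearEquiv.ofInjectiveEndo f hf, fun x => rfl⟩

theorem exists_triDet_pos {L : Set Plane} (hi : (interior L).Nonempty) :
    ∃ a ∈ L, ∃ b ∈ L, ∃ c ∈ L, 0 < triDet a b c := by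
  obtain ⟨a, ha⟩ := hi
  obtain ⟨ε, hε, hball⟩ := Metric.mem_nhds_iff.mp (mem_interior_iff_mem_nhds.mp ha)
  have key : ∀ i : Fin 2, a + EuclideanSpace.single i (ε / 2) ∈ L := fun i => hball (by
    rw [Metric.mem_ball, dist_eq_norm, add_sub_cancel_left, PiLp.norm_single,
      Real.norm_of_nonneg (by positivity)]
    linarith)
  refine ⟨a, interior_subset ha, _, key 0, _, key 1, ?_⟩
  simp [triDet]
  positivity

/-- Every symmetric convex body has an affine copy that contains the triangle `(0,0)`, `(1,0)`,
`(0,1)` and lies in the anticomplementary triangle of it; moreover the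
barycentric coordinate of its center `m` that belongs to `(0,0)` can be made the smallest of the
three. -/
theorem exists_maximal_triangle_position {L : Set Plane} (hL : IsConvexBody L)
    (hs : IsCentrallySymmetric L) :
    ∃ (h : Plane ≃ₗ[ℝ] Plane) (p m : Plane),
      h !₂[0, 0] + p ∈ L ∧ h !₂[1, 0] + p ∈ L ∧ h !₂[0, 1] + p ∈ L ∧
      (∀ x, h x + p ∈ L → h ((2 : ℝ) • m - x) + p ∈ L) ∧
      (∀ x, h x + p ∈ L → x 0 ≤ 1 ∧ x 1 ≤ 1 ∧ 0 ≤ x 0 + x 1) ∧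
      1 - m 0 - m 1 ≤ m 0 ∧ 1 - m 0 - m 1 ≤ m 1 := by
  obtain ⟨-, hcpt, hi⟩ := hL
  obtain ⟨z, hz⟩ := hs
  obtain ⟨a₀, ha₀, b₀, hb₀, c₀, hc₀, hpos₀⟩ := exists_triDet_pos hi
  have hcont : Continuous fun q : Plane × Plane × Plane => triDet q.1 q.2.1 q.2.2 := by
    unfold triDet; fun_prop
  obtain ⟨⟨a, b, c⟩, ⟨ha, hb, hc⟩, hmax⟩ := (hcpt.prod (hcpt.prod hcpt)).exists_isMaxOn
    ⟨(a₀, b₀, c₀), ha₀, hb₀, hc₀⟩ hcont.continuousOn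
  have hmax' : ∀ x ∈ L, ∀ y ∈ L, ∀ w ∈ L, triDet x y w ≤ triDet a b c :=
    fun x hx y hy w hw => hmax (show (x, y, w) ∈ L ×ˢ L ×ˢ L from ⟨hx, hy, hw⟩)
  -- the vertex to be sent to the origin is the one with the smallest barycentric coordinate
  have hcyc : ∃ a ∈ L, ∃ b ∈ L, ∃ c ∈ L, 0 < triDet a b c ∧
      (∀ x ∈ L, ∀ y ∈ L, ∀ w ∈ L, triDet x y w ≤ triDet a b c) ∧
      triDet z b c ≤ triDet z c a ∧ triDet z b c ≤ triDet z a b := by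
    have hpos : 0 < triDet a b c := hpos₀.trans_le (hmax' _ ha₀ _ hb₀ _ hc₀)
    have e1 : triDet b c a = triDet a b c := by unfold triDet; ring
    have e2 : triDet c a b = triDet a b c := by unfold triDet; ring
    rcases le_total (triDet z b c) (triDet z c a) with h1 | h1 <;>
    rcases le_total (triDet z b c) (triDet z a b) with h2 | h2 <;>
    rcases le_total (triDet z c a) (triDet z a b) with h3 | h3
    · exact ⟨a, ha, b, hb, c, hc, hpos, hmax', h1, h2⟩
    · exact ⟨a, ha, b, hb, c, hc, hpos, hmax', h1, h2⟩
    · exact ⟨c, hc, a, ha, b, hb, e2 ▸ hpos, e2 ▸ hmax', h2, h2.trans h1⟩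
    · exact ⟨c, hc, a, ha, b, hb, e2 ▸ hpos, e2 ▸ hmax', h2, h3⟩
    · exact ⟨b, hb, c, hc, a, ha, e1 ▸ hpos, e1 ▸ hmax', h3, h1⟩
    · exact ⟨b, hb, c, hc, a, ha, e1 ▸ hpos, e1 ▸ hmax', h1.trans h2, h1⟩
    · exact ⟨b, hb, c, hc, a, ha, e1 ▸ hpos, e1 ▸ hmax', h3, h1⟩
    · exact ⟨c, hc, a, ha, b, hb, e2 ▸ hpos, e2 ▸ hmax', h2, h3⟩
  clear hmax hmax' ha hb hc
  obtain ⟨a, ha, b, hb, c, hc, hpos, hmax, ho1, ho2⟩ := hcyc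
  obtain ⟨h, hh⟩ := exists_linearEquiv_columns (b - a) (c - a) (by
    have := hpos.ne'
    simpa [triDet] using this)
  have hx : ∀ x, h x + a = x 0 • (b - a) + x 1 • (c - a) + a := fun x => by rw [hh]
  -- areas of triangles with one new vertex are barycentric coordinates
  have hd1 : ∀ x, triDet (h x + a) b c = (1 - x 0 - x 1) * triDet a b c := fun x => by
    rw [hx]; simp [triDet]; ring
  have hd2 : ∀ x, triDet (h x + a) c a = x 0 * triDet a b c := fun x => by
    rw [hx]; simp [triDet]; ring
  have hd3 : ∀ x, triDet (h x + a) a b = x 1 * triDet a b c := fun x => by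
    rw [hx]; simp [triDet]; ring
  have hm : h (h.symm (z - a)) + a = z := by simp
  refine ⟨h, a, h.symm (z - a), ?_, ?_, ?_, fun x hxL => ?_, fun x hxL => ⟨?_, ?_, ?_⟩, ?_, ?_⟩
  · rw [hx]; simpa using ha
  · rw [hx]; simpa using hb
  · rw [hx]; simpa using hc
  · have := hz _ hxL
    convert this using 1
    rw [map_sub, map_smul, LinearEquiv.apply_symm_apply]; module
  · have := hmax _ hxL _ hc _ ha
    rw [hd2] at this; nlinarith
  · have := hmax _ hxL _ ha _ hb
    rw [hd3] at this; nlinarith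
  · have := hmax _ hxL _ hb _ hc
    rw [hd1] at this; nlinarith
  · rw [← hm, hd1, hd2] at ho1; nlinarith
  · rw [← hm, hd1, hd3] at ho2; nlinarith

/-! ### The sandwich around a maximal triangle -/

theorem mem_of_mem_triangle {S : Set Plane} (hS : Convex ℝ S) (h0 : !₂[0, 0] ∈ S)
    (h1 : !₂[1, 0] ∈ S) (h2 : !₂[0, 1] ∈ S) {x : Plane} (hx0 : 0 ≤ x 0) (hx1 : 0 ≤ x 1)
    (hx : x 0 + x 1 ≤ 1) : x ∈ S := by
  have := hS.sum_mem (t := Finset.univ) (w := ![1 - x 0 - x 1, x 0, x 1])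
    (z := ![!₂[0, 0], !₂[1, 0], !₂[0, 1]])
    (by intro i _; fin_cases i <;> simp <;> linarith) (by simp [Fin.sum_univ_three]; ring)
    (by intro i _; fin_cases i <;> simpa)
  convert this using 1
  ext i; fin_cases i <;> simp [Fin.sum_univ_three]

/-- If `K` touches all three sides of the triangle `x ≥ 0`, `y ≥ 0`, `x + y ≤ s` and contains
`(0,0)`, `(1,0)`, `(0,1)`, then adding up its extents in three directions bounds its asymmetry. -/
theorem two_div_le_of_isAsymmetryBound {K : Set Plane} {s : ℝ} (hs : 0 < s) (h0 : !₂[0, 0] ∈ K)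
    (h1 : !₂[1, 0] ∈ K) (h2 : !₂[0, 1] ∈ K) (hK : ∀ x ∈ K, 0 ≤ x 0 ∧ 0 ≤ x 1 ∧ x 0 + x 1 ≤ s)
    {t : ℝ} (ht : IsAsymmetryBound K t) : 2 / s ≤ t := by
  obtain ⟨ht, c, hc⟩ := ht
  obtain ⟨y, hy, e0⟩ := hc _ h0
  obtain ⟨z, hz, e1⟩ := hc _ h1
  obtain ⟨w, hw, e2⟩ := hc _ h2
  have e00 := congrArg (fun x : Plane => x 0) e0
  have e01 := congrArg (fun x : Plane => x 1) e0
  have e10 := congrArg (fun x : Plane => x 0) e1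
  have e21 := congrArg (fun x : Plane => x 1) e2
  simp at e00 e01 e10 e21
  rw [div_le_iff₀ hs]
  nlinarith [mul_nonneg ht.le (hK z hz).1, mul_nonneg ht.le (hK w hw).2.1,
    mul_le_mul_of_nonneg_left (hK y hy).2.2 ht.le]

/-- The sandwich obtained from a triangle of maximal area in `L`. If `L` is in the position of
`exists_maximal_triangle_position`, its center `m` satisfies `1/4 ≤ m₀, m₁ ≤ 1/2`; hence `L`
contains `2m` and lies in the region of the hypothesis `hout`. -/
theorem hasAffineSandwich_of_maximal_triangle {K : Set Plane} {s : ℝ}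
    (hin : ∀ m : Plane, 1 - m 0 - m 1 ≤ m 0 → 1 - m 0 - m 1 ≤ m 1 →
      ∀ S : Set Plane, Convex ℝ S → !₂[0, 0] ∈ S → !₂[1, 0] ∈ S → !₂[0, 1] ∈ S →
        (2 : ℝ) • m ∈ S → K ⊆ S)
    (hout : ∀ x : Plane, -(1 / 2) ≤ x 0 → -(1 / 2) ≤ x 1 → x 0 ≤ 1 → x 1 ≤ 1 → 0 ≤ x 0 + x 1 →
      ∃ k ∈ K, x = -((2 / s) • k) + !₂[1, 1])
    {L : Set Plane} (hL : IsConvexBody L) (hLs : IsCentrallySymmetric L) :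
    HasAffineSandwich K L (2 / s) := by
  obtain ⟨h, p, m, h0, h1, h2, hsym, hb, ho1, ho2⟩ := exists_maximal_triangle_position hL hLs
  have hm := hsym _ h0
  have hmb := hb _ hm
  simp at hmb
  have hm' : h ((2 : ℝ) • m) + p ∈ L := by
    convert hm using 3
    ext i; fin_cases i <;> simp
  refine ⟨h, p, (2 : ℝ) • m - !₂[1, 1], fun k hk => ?_, fun y hy => ?_⟩
  · refine hin m ho1 ho2 {x | h x + p ∈ L} ?_ h0 h1 h2 hm' hk
    intro x hx y hy a b ha hb' hab
    have := hL.1 hx hy ha hb' hab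
    have e : h (a • x + b • y) + p = a • (h x + p) + b • (h y + p) := by
      rw [map_add, map_smul, map_smul]
      linear_combination (norm := module) (-hab) • p
    rw [Set.mem_ofPred_eq, e]
    exact this
  · have hx : h (h.symm (y - p)) + p = y := by simp
    set x := h.symm (y - p)
    rw [← hx] at hy
    obtain ⟨b1, b2, b3⟩ := hb _ hy
    have hx' := hsym _ hy
    obtain ⟨c1, c2, c3⟩ := hb _ hx'
    have hx'' := hsym _ hx'
    simp at c1 c2 c3
    obtain ⟨k, hk, e⟩ := hout ((2 : ℝ) • m - x) (by simp; linarith) (by simp; linarith)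
      (by simpa using c1) (by simpa using c2) (by simp; linarith)
    refine ⟨k, hk, ?_⟩
    rw [← hx]
    congr 2
    linear_combination (norm := module) -e

/-! ### The pentagons -/

/-- The vertices of the pentagon: the triangle `(0,0)`, `(1,0)`, `(0,1)` and two further points on
the line `x + y = s`, exchanged by the reflection `(x, y) ↦ (y, x)`. -/
def pentagonVertex (s τ : ℝ) : Fin 5 → Plane :=
  ![!₂[0, 0], !₂[1, 0], !₂[0, 1], !₂[s - τ, τ], !₂[τ, s - τ]]

/-- The pentagon with vertices `pentagonVertex s τ`. -/
def pentagon (s τ : ℝ) : Set Plane := convexHull ℝ (Set.range (pentagonVertex s τ))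

theorem pentagonVertex_mem (s τ : ℝ) (i : Fin 5) : pentagonVertex s τ i ∈ pentagon s τ :=
  subset_convexHull ℝ _ ⟨i, rfl⟩

theorem pentagon_subset_of_convex {s τ : ℝ} {S : Set Plane} (hS : Convex ℝ S)
    (h : ∀ i, pentagonVertex s τ i ∈ S) : pentagon s τ ⊆ S :=
  convexHull_min (by rintro _ ⟨i, rfl⟩; exact h i) hS

/-- The range of parameters for which the pentagon has constant distance `2 / s` to all symmetric
convex bodies. It is a proper interval in `τ` precisely for `s < 8 / 7`. -/
structure PentagonParam (s τ : ℝ) : Prop where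
  one_lt : 1 < s
  le_tau : 2 * (s - 1) ≤ τ
  tau_le : τ ≤ s / 4

namespace PentagonParam

variable {s τ : ℝ}

theorem s_le (h : PentagonParam s τ) : s ≤ 8 / 7 := by
  have := h.le_tau; have := h.tau_le; linarith

theorem bounds (h : PentagonParam s τ) : ∀ x ∈ pentagon s τ,
    (0 ≤ x 0 ∧ x 0 ≤ 1) ∧ (0 ≤ x 1 ∧ x 1 ≤ 1) ∧ x 0 + x 1 ≤ s := by
  have h1 := h.one_lt
  have h2 := h.le_tau
  have h3 := h.tau_le
  refine pentagon_subset_of_convex (S := {x : Plane | (0 ≤ x 0 ∧ x 0 ≤ 1) ∧ (0 ≤ x 1 ∧ x 1 ≤ 1) ∧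
    x 0 + x 1 ≤ s}) ?_ ?_
  · rintro x ⟨⟨a1, a2⟩, ⟨a3, a4⟩, a5⟩ y ⟨⟨b1, b2⟩, ⟨b3, b4⟩, b5⟩ a b ha hb hab
    simp only [Set.mem_ofPred_eq, PiLp.add_apply, PiLp.smul_apply, smul_eq_mul]
    obtain rfl : b = 1 - a := by linarith
    refine ⟨⟨?_, ?_⟩, ⟨?_, ?_⟩, ?_⟩ <;> nlinarith
  · intro i
    fin_cases i <;> refine ⟨⟨?_, ?_⟩, ⟨?_, ?_⟩, ?_⟩ <;> simp [pentagonVertex] <;> linarith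

/-- The pentagon contains the pentagonal region onto which `x ↦ (s / 2) ((1, 1) - x)` maps the part
of the plane that can be occupied by a symmetric body around a maximal triangle. The upper bound
for `τ` serves to put the point `(3 s / 4, s / 4)` on the boundary of the pentagon. -/
theorem mem_of_le (h : PentagonParam s τ) {x : Plane} (h0 : 0 ≤ x 0) (h1 : 0 ≤ x 1)
    (h0' : x 0 ≤ 3 / 4 * s) (h1' : x 1 ≤ 3 / 4 * s) (hx : x 0 + x 1 ≤ s) : x ∈ pentagon s τ := by
  have g1 := h.one_lt
  have g2 := h.le_tau
  have g3 := h.tau_le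
  have g4 := h.s_le
  have hS : Convex ℝ (pentagon s τ) := convex_convexHull ℝ _
  have hV := pentagonVertex_mem s τ
  have hT : ∀ y : Plane, 0 ≤ y 0 → 0 ≤ y 1 → y 0 + y 1 ≤ 1 → y ∈ pentagon s τ := fun y =>
    mem_of_mem_triangle hS (hV 0) (hV 1) (hV 2)
  -- the part of the segment between the last two vertices
  have hE : ∀ b, s / 4 ≤ b → b ≤ 3 / 4 * s → !₂[s - b, b] ∈ pentagon s τ := by
    intro b hb hb'
    have hd : 0 < s - 2 * τ := by linarith
    set l : ℝ := (b - τ) / (s - 2 * τ) with hl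
    have hl' : l * (s - 2 * τ) = b - τ := div_mul_cancel₀ _ hd.ne'
    have hl1 : l ≤ 1 := by rw [hl, div_le_one hd]; linarith
    have := hS (hV 3) (hV 4) (a := 1 - l) (b := l) (by linarith)
      (div_nonneg (by linarith) hd.le) (by ring)
    convert this using 1
    ext i; fin_cases i <;> simp [pentagonVertex] <;> linarith
  have hend : ∃ d, x 0 ≤ d ∧ 0 < d ∧ !₂[d, x 1] ∈ pentagon s τ := by
    rcases le_total (x 1) (s / 4) with hb | hb
    · refine ⟨3 / 4 * s, h0', by linarith, ?_⟩
      have e := hE (s / 4) le_rfl (by linarith)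
      have f := hT !₂[3 / 4 * s, 0] (by simp; linarith) (by simp) (by simp; linarith)
      have := hS f e (a := 1 - x 1 / (s / 4)) (b := x 1 / (s / 4))
        (by rw [sub_nonneg, div_le_one (by linarith)]; exact hb) (by positivity) (by ring)
      convert this using 1
      ext i; fin_cases i
      · simp; field_simp; ring
      · simp; field_simp
    · exact ⟨s - x 1, by linarith, by linarith, hE _ hb h1'⟩
  obtain ⟨d, hd, hd0, hd'⟩ := hend
  have f := hT !₂[0, x 1] (by simp) (by simpa using h1) (by simp; linarith)
  have := hS f hd' (a := 1 - x 0 / d) (b := x 0 / d)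
    (by rw [sub_nonneg, div_le_one hd0]; exact hd) (by positivity) (by ring)
  convert this using 1
  ext i; fin_cases i
  · simp; field_simp
  · simp; field_simp; ring

theorem interior_nonempty (h : PentagonParam s τ) : (interior (pentagon s τ)).Nonempty := by
  have g1 := h.one_lt
  refine ⟨!₂[1 / 4, 1 / 4], mem_interior.mpr
    ⟨{x : Plane | 0 < x 0 ∧ 0 < x 1 ∧ x 0 < 1 / 2 ∧ x 1 < 1 / 2}, ?_, ?_, ?_⟩⟩
  · rintro x ⟨a, b, c, d⟩
    exact h.mem_of_le a.le b.le (by linarith) (by linarith) (by linarith)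
  · refine IsOpen.and (isOpen_lt (by fun_prop) (by fun_prop)) (IsOpen.and
      (isOpen_lt (by fun_prop) (by fun_prop)) (IsOpen.and
      (isOpen_lt (by fun_prop) (by fun_prop)) (isOpen_lt (by fun_prop) (by fun_prop))))
  · norm_num

/-- The two additional vertices lie in every convex set that contains the triangle and the
reflection `2m` of the origin, provided that the barycentric coordinate of `m` that belongs to the
origin is the smallest one. This is where the lower bound for `τ` is needed. -/
theorem subset_of_reflection (h : PentagonParam s τ) {m : Plane} (ho1 : 1 - m 0 - m 1 ≤ m 0) (ho2 : 1 - m 0 - m 1 ≤ m 1) {S : Set Plane}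
    (hS : Convex ℝ S) (h0 : !₂[0, 0] ∈ S) (h1 : !₂[1, 0] ∈ S) (h2 : !₂[0, 1] ∈ S)
    (hm : (2 : ℝ) • m ∈ S) : pentagon s τ ⊆ S := by
  have g1 := h.one_lt
  have g2 := h.le_tau
  have g3 := h.tau_le
  have g4 := h.s_le
  have hd : 0 < 2 * (m 0 + m 1) - 1 := by linarith
  -- `2m` has weight `l` in the barycentric coordinates with respect to `2m`, `(1,0)`, `(0,1)`
  set l : ℝ := (s - 1) / (2 * (m 0 + m 1) - 1) with hl
  have hl' : l * (2 * (m 0 + m 1) - 1) = s - 1 := div_mul_cancel₀ _ hd.ne'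
  have hl0 : 0 ≤ l := div_nonneg (by linarith) hd.le
  have key : ∀ x : Plane, x 0 + x 1 = s → 2 * (s - 1) ≤ x 0 → 2 * (s - 1) ≤ x 1 → x ∈ S := by
    intro x hx hx0 hx1
    have := hS.sum_mem (t := Finset.univ) (w := ![l, x 0 - 2 * l * m 0, x 1 - 2 * l * m 1])
      (z := ![(2 : ℝ) • m, !₂[1, 0], !₂[0, 1]])
      (by
        intro i _
        fin_cases i <;> simp
        · exact hl0
        · nlinarith
        · nlinarith)
      (by simp [Fin.sum_univ_three]; linarith)
      (by intro i _; fin_cases i <;> simpa)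
    convert this using 1
    ext i; fin_cases i <;> simp [Fin.sum_univ_three] <;> ring
  refine pentagon_subset_of_convex hS fun i => ?_
  fin_cases i
  · exact h0
  · exact h1
  · exact h2
  · exact key _ (by simp [pentagonVertex]) (by simp [pentagonVertex]; linarith)
      (by simp [pentagonVertex]; linarith)
  · exact key _ (by simp [pentagonVertex]) (by simp [pentagonVertex]; linarith)
      (by simp [pentagonVertex]; linarith)

theorem exists_reflected_mem (h : PentagonParam s τ) {x : Plane} (h0 : -(1 / 2) ≤ x 0)
    (h1 : -(1 / 2) ≤ x 1) (h0' : x 0 ≤ 1) (h1' : x 1 ≤ 1) (hx : 0 ≤ x 0 + x 1) :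
    ∃ k ∈ pentagon s τ, x = -((2 / s) • k) + !₂[1, 1] := by
  have g1 := h.one_lt
  refine ⟨(s / 2) • (!₂[1, 1] - x), h.mem_of_le ?_ ?_ ?_ ?_ ?_, ?_⟩
  · simp; nlinarith
  · simp; nlinarith
  · simp; nlinarith
  · simp; nlinarith
  · simp; nlinarith
  · rw [smul_smul, show 2 / s * (s / 2) = 1 by field_simp, one_smul]; abel

theorem isAsymmetryBound_le (h : PentagonParam s τ) {t : ℝ}
    (ht : IsAsymmetryBound (pentagon s τ) t) : 2 / s ≤ t :=
  two_div_le_of_isAsymmetryBound (by linarith [h.one_lt]) (pentagonVertex_mem s τ 0)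
    (pentagonVertex_mem s τ 1) (pentagonVertex_mem s τ 2)
    (fun x hx => ⟨(h.bounds x hx).1.1, (h.bounds x hx).2.1.1, (h.bounds x hx).2.2⟩) ht

theorem asymmetryConst_pentagon (h : PentagonParam s τ) : asymmetryConst (pentagon s τ) = 2 / s := by
  refine asymmetryConst_eq (convex_convexHull ℝ _) h.interior_nonempty
    ⟨div_pos two_pos (by linarith [h.one_lt]), !₂[1, 1], fun x hx => ?_⟩
    fun t ht => h.isAsymmetryBound_le ht
  obtain ⟨⟨a, b⟩, ⟨c, d⟩, -⟩ := h.bounds x hx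
  exact h.exists_reflected_mem (by linarith) (by linarith) b d (by linarith)

theorem equidistant_pentagon (h : PentagonParam s τ) :
    EquidistantToSymmetric (pentagon s τ) (2 / s) := by
  refine equidistantToSymmetric_of_sandwich ?_ (fun t ht => h.isAsymmetryBound_le ht)
    fun L hL hLs => hasAffineSandwich_of_maximal_triangle ?_ ?_ hL hLs
  · rw [lt_div_iff₀ (by linarith [h.one_lt])]; linarith [h.s_le]
  · exact fun m a b S => h.subset_of_reflection a b
  · exact fun x a b c d e => h.exists_reflected_mem a b c d e

end PentagonParam

/-- A family of points each of which is the unique maximizer of a linear functional. -/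
theorem convexIndependent_of_exposed {ι : Type*} {p : ι → Plane}
    (h : ∀ i, ∃ a b : ℝ, ∀ j, j ≠ i → a * p j 0 + b * p j 1 < a * p i 0 + b * p i 1) :
    ConvexIndependent ℝ p := by
  rw [convexIndependent_iff_notMem_convexHull_sdiff]
  intro i s hi
  obtain ⟨a, b, hab⟩ := h i
  have hconv : Convex ℝ {x : Plane | a * x 0 + b * x 1 < a * p i 0 + b * p i 1} := by
    intro x hx y hy α β hα hβ hαβ
    simp only [Set.mem_ofPred_eq, PiLp.add_apply, PiLp.smul_apply, smul_eq_mul] at hx hy ⊢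
    obtain rfl : β = 1 - α := by linarith
    rcases hα.eq_or_lt with rfl | hα'
    · simpa using hy
    · nlinarith
  have := convexHull_min (s := p '' (s \ {i})) (by
    rintro _ ⟨j, hj, rfl⟩
    exact hab j hj.2) hconv hi
  exact lt_irrefl (a * p i 0 + b * p i 1) this

theorem PentagonParam.convexIndependent {s τ : ℝ} (h : PentagonParam s τ) :
    ConvexIndependent ℝ (pentagonVertex s τ) := by
  have g1 := h.one_lt
  have g2 := h.le_tau
  have g3 := h.tau_le
  have g4 := h.s_le
  refine convexIndependent_of_exposed fun i => ?_
  fin_cases i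
  · refine ⟨-1, -1, fun j hj => ?_⟩
    fin_cases j <;> simp [pentagonVertex] at hj ⊢ <;> linarith
  · refine ⟨1, 0, fun j hj => ?_⟩
    fin_cases j <;> simp [pentagonVertex] at hj ⊢ <;> linarith
  · refine ⟨0, 1, fun j hj => ?_⟩
    fin_cases j <;> simp [pentagonVertex] at hj ⊢ <;> linarith
  · refine ⟨τ + (s - 1), τ, fun j hj => ?_⟩
    fin_cases j <;> simp [pentagonVertex] at hj ⊢ <;> nlinarith
  · refine ⟨τ, τ + (s - 1), fun j hj => ?_⟩
    fin_cases j <;> simp [pentagonVertex] at hj ⊢ <;> nlinarith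

theorem PentagonParam.isConvexPentagon {s τ : ℝ} (h : PentagonParam s τ) :
    IsConvexPentagon (pentagon s τ) :=
  ⟨_, h.convexIndependent, rfl⟩

/-! ### Affine inequivalence -/

/-- The extreme points of the convex hull of a finite convexly independent family are its
members. -/
theorem ConvexIndependent.extremePoints_convexHull_range {ι : Type*} [Finite ι] {p : ι → Plane}
    (hp : ConvexIndependent ℝ p) :
    (convexHull ℝ (Set.range p)).extremePoints ℝ = Set.range p := by
  refine Set.Subset.antisymm extremePoints_convexHull_subset ?_
  rintro _ ⟨i, rfl⟩
  by_contra hi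
  set E := (convexHull ℝ (Set.range p)).extremePoints ℝ with hE
  have hE' : E ⊆ p '' (Set.univ \ {i}) := by
    intro x hx
    obtain ⟨j, rfl⟩ := extremePoints_convexHull_subset hx
    exact ⟨j, ⟨trivial, fun hj => hi (by rw [Set.mem_singleton_iff] at hj; rwa [← hj])⟩, rfl⟩
  have hfin : (Set.range p).Finite := Set.finite_range p
  have hKM := closure_convexHull_extremePoints (hfin.isCompact_convexHull (𝕜 := ℝ)) (convex_convexHull ℝ _)
  have hclosed : IsClosed (convexHull ℝ (p '' (Set.univ \ {i}))) :=
    (((Set.toFinite _).image p).isCompact_convexHull (𝕜 := ℝ)).isClosed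
  have hmem : p i ∈ closure (convexHull ℝ E) := by
    rw [hE, hKM]; exact subset_convexHull ℝ _ ⟨i, rfl⟩
  have := closure_minimal (convexHull_mono hE') hclosed hmem
  exact (convexIndependent_iff_notMem_convexHull_sdiff.mp hp) i _ this

/-- Affine maps multiply all areas by the same factor. -/
theorem exists_triDet_affineEquiv (f : Plane ≃ᵃ[ℝ] Plane) :
    ∃ δ : ℝ, ∀ a b c, triDet (f a) (f b) (f c) = δ * triDet a b c := by
  set u := f.linear !₂[1, 0] with hu
  set v := f.linear !₂[0, 1] with hv
  have key : ∀ x, f x = x 0 • u + x 1 • v + f 0 := by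
    intro x
    have h1 : f x = f.linear x + f 0 := by
      have := f.map_vadd 0 x
      simpa using this
    have h2 : x = x 0 • !₂[1, 0] + x 1 • !₂[0, 1] := by
      ext i; fin_cases i <;> simp
    rw [h1]
    conv_lhs => rw [h2]
    rw [map_add, map_smul, map_smul]
  refine ⟨u 0 * v 1 - u 1 * v 0, fun a b c => ?_⟩
  rw [key a, key b, key c]
  simp [triDet]
  ring

theorem PentagonParam.abs_triDet_le {s τ : ℝ} (h : PentagonParam s τ) (i j k : Fin 5) :
    |triDet (pentagonVertex s τ i) (pentagonVertex s τ j) (pentagonVertex s τ k)| ≤ 1 := by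
  have g1 := h.one_lt
  have g2 := h.le_tau
  have g3 := h.tau_le
  have g4 := h.s_le
  rw [abs_le]
  constructor <;>
  fin_cases i <;> fin_cases j <;> fin_cases k <;> simp [triDet, pentagonVertex] <;> nlinarith

theorem sum_sq_triDet_pentagonVertex (s τ : ℝ) :
    ∑ i, ∑ j, ∑ k,
      triDet (pentagonVertex s τ i) (pentagonVertex s τ j) (pentagonVertex s τ k) ^ 2 =
      6 * (1 + s ^ 2 + 2 * (s - 1) ^ 2) * (1 + (s - 2 * τ) ^ 2) := by
  simp [triDet, pentagonVertex, Fin.sum_univ_five]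
  ring

/-- The parameter `τ` is an affine invariant: the triangles spanned by the vertices of either
pentagon have normalized area at most `1`, with equality attained, so an affine map between the
pentagons preserves area, and the sum of the squared areas determines `τ`. -/
theorem PentagonParam.eq_of_affinelyEquivalent {s τ τ' : ℝ} (h : PentagonParam s τ)
    (h' : PentagonParam s τ') (he : AffinelyEquivalent (pentagon s τ) (pentagon s τ')) :
    τ = τ' := by
  obtain ⟨f, hf⟩ := he
  have hrange : Set.range (pentagonVertex s τ') = Set.range (f ∘ pentagonVertex s τ) := by
    have hi : ConvexIndependent ℝ (f ∘ pentagonVertex s τ) := by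
      rw [convexIndependent_iff_notMem_convexHull_sdiff]
      intro i t hi
      rw [Set.image_comp, ← AffineEquiv.coe_toAffineMap, ← AffineMap.image_convexHull] at hi
      obtain ⟨x, hx, hxi⟩ := hi
      obtain rfl : x = pentagonVertex s τ i := f.injective hxi
      exact convexIndependent_iff_notMem_convexHull_sdiff.mp h.convexIndependent i t hx
    rw [← h'.convexIndependent.extremePoints_convexHull_range,
      ← hi.extremePoints_convexHull_range, Set.range_comp, ← AffineEquiv.coe_toAffineMap,
      ← AffineMap.image_convexHull, AffineEquiv.coe_toAffineMap]
    exact congrArg _ hf.symm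
  have hπ : ∀ i, ∃ j, pentagonVertex s τ' j = f (pentagonVertex s τ i) := fun i => by
    have : f (pentagonVertex s τ i) ∈ Set.range (pentagonVertex s τ') := hrange ▸ ⟨i, rfl⟩
    exact this
  choose π hπ using hπ
  have hinj : Function.Injective π := fun i j hij => by
    have := (hπ i).symm.trans ((congrArg _ hij).trans (hπ j))
    exact h.convexIndependent.injective (f.injective this)
  let e : Fin 5 ≃ Fin 5 := Equiv.ofBijective π (Finite.injective_iff_bijective.mp hinj)
  obtain ⟨δ, hδ⟩ := exists_triDet_affineEquiv f
  have hdet : ∀ i j k, triDet (pentagonVertex s τ' (e i)) (pentagonVertex s τ' (e j))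
      (pentagonVertex s τ' (e k)) =
      δ * triDet (pentagonVertex s τ i) (pentagonVertex s τ j) (pentagonVertex s τ k) :=
    fun i j k => by
      rw [← hδ, ← hπ i, ← hπ j, ← hπ k]; rfl
  have hone : ∀ σ, triDet (pentagonVertex s σ 0) (pentagonVertex s σ 1) (pentagonVertex s σ 2) = 1 :=
    fun σ => by simp [triDet, pentagonVertex]
  have hδ1 : |δ| = 1 := by
    apply le_antisymm
    · have h1 := hdet 0 1 2
      rw [hone, mul_one] at h1
      rw [← h1]
      exact h'.abs_triDet_le _ _ _
    · have h1 := hdet (e.symm 0) (e.symm 1) (e.symm 2)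
      simp only [Equiv.apply_symm_apply, hone] at h1
      have h2 := congrArg abs h1
      rw [abs_one, abs_mul] at h2
      rw [h2]
      exact mul_le_of_le_one_right (abs_nonneg _) (h.abs_triDet_le _ _ _)
  have hsum : ∑ i, ∑ j, ∑ k, triDet (pentagonVertex s τ i) (pentagonVertex s τ j)
      (pentagonVertex s τ k) ^ 2 = ∑ i, ∑ j, ∑ k, triDet (pentagonVertex s τ' i)
      (pentagonVertex s τ' j) (pentagonVertex s τ' k) ^ 2 := by
    symm
    rw [← Equiv.sum_comp e]
    refine Finset.sum_congr rfl fun i _ => ?_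
    rw [← Equiv.sum_comp e]
    refine Finset.sum_congr rfl fun j _ => ?_
    rw [← Equiv.sum_comp e]
    refine Finset.sum_congr rfl fun k _ => ?_
    rw [hdet, mul_pow, ← sq_abs δ, hδ1, one_pow, one_mul]
  rw [sum_sq_triDet_pentagonVertex, sum_sq_triDet_pentagonVertex] at hsum
  have hc : (0 : ℝ) < 6 * (1 + s ^ 2 + 2 * (s - 1) ^ 2) := by positivity
  have h3 := mul_left_cancel₀ hc.ne' hsum
  have h4 : s - 2 * τ = s - 2 * τ' :=
    (sq_eq_sq₀ (by linarith [h.tau_le, h.one_lt]) (by linarith [h'.tau_le, h'.one_lt])).mp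
      (by linarith)
  linarith

/-! ### The triangle -/

theorem exists_equidistant_triangle :
    ∃ K : Set Plane, IsTriangle K ∧ asymmetryConst K = 2 ∧ EquidistantToSymmetric K 2 := by
  set q : Fin 3 → Plane := ![!₂[0, 0], !₂[1, 0], !₂[0, 1]] with hq
  set K := convexHull ℝ (Set.range q) with hK
  have hV : ∀ i, q i ∈ K := fun i => subset_convexHull ℝ _ ⟨i, rfl⟩
  have hT : ∀ x : Plane, 0 ≤ x 0 → 0 ≤ x 1 → x 0 + x 1 ≤ 1 → x ∈ K := fun x =>
    mem_of_mem_triangle (convex_convexHull ℝ _) (hV 0) (hV 1) (hV 2)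
  have hb : ∀ x ∈ K, 0 ≤ x 0 ∧ 0 ≤ x 1 ∧ x 0 + x 1 ≤ 1 := by
    refine convexHull_min (t := {x : Plane | 0 ≤ x 0 ∧ 0 ≤ x 1 ∧ x 0 + x 1 ≤ 1}) ?_ ?_
    · rintro _ ⟨i, rfl⟩
      fin_cases i <;> simp [hq]
    · rintro x ⟨a1, a2, a3⟩ y ⟨b1, b2, b3⟩ a b ha hb hab
      simp only [Set.mem_ofPred_eq, PiLp.add_apply, PiLp.smul_apply, smul_eq_mul]
      obtain rfl : b = 1 - a := by linarith
      refine ⟨?_, ?_, ?_⟩ <;> nlinarith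
  have hi : (interior K).Nonempty := by
    refine ⟨!₂[1 / 4, 1 / 4], mem_interior.mpr
      ⟨{x : Plane | 0 < x 0 ∧ 0 < x 1 ∧ x 0 + x 1 < 1}, ?_, ?_, ?_⟩⟩
    · rintro x ⟨a, b, c⟩
      exact hT x a.le b.le c.le
    · exact IsOpen.and (isOpen_lt (by fun_prop) (by fun_prop)) (IsOpen.and
        (isOpen_lt (by fun_prop) (by fun_prop)) (isOpen_lt (by fun_prop) (by fun_prop)))
    · norm_num
  have hout : ∀ x : Plane, x 0 ≤ 1 → x 1 ≤ 1 → 0 ≤ x 0 + x 1 →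
      ∃ k ∈ K, x = -((2 / 1 : ℝ) • k) + !₂[1, 1] := by
    intro x h0 h1 h2
    refine ⟨(1 / 2 : ℝ) • (!₂[1, 1] - x), hT _ ?_ ?_ ?_, by module⟩ <;> simp <;> linarith
  have hmin : ∀ t, IsAsymmetryBound K t → 2 ≤ t := fun t ht => by
    simpa using two_div_le_of_isAsymmetryBound one_pos (hV 0) (hV 1) (hV 2) hb ht
  refine ⟨K, ⟨q, ?_, rfl⟩, ?_, ?_⟩
  · rw [affineIndependent_iff_not_collinear, collinear_iff_of_mem (Set.mem_range_self (f := q) 0)]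
    rintro ⟨v, hv⟩
    obtain ⟨a, ha⟩ := hv (q 1) ⟨1, rfl⟩
    obtain ⟨b, hb⟩ := hv (q 2) ⟨2, rfl⟩
    have a0 := congrArg (fun x : Plane => x 0) ha
    have a1 := congrArg (fun x : Plane => x 1) ha
    have b0 := congrArg (fun x : Plane => x 0) hb
    have b1 := congrArg (fun x : Plane => x 1) hb
    simp [hq] at a0 a1 b0 b1
    rcases a1 with h | h <;> rcases b0 with h' | h' <;> simp_all
  · refine asymmetryConst_eq (convex_convexHull ℝ _) hi ⟨two_pos, !₂[1, 1], fun x hx => ?_⟩ hmin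
    obtain ⟨a, b, c⟩ := hb x hx
    simpa using hout x (by linarith) (by linarith) (by linarith)
  · refine equidistantToSymmetric_of_sandwich one_lt_two hmin fun L hL hLs => ?_
    simpa using hasAffineSandwich_of_maximal_triangle (K := K) (s := 1)
      (fun m _ _ S hS h0 h1 h2 _ => convexHull_min (by
        rintro _ ⟨i, rfl⟩
        fin_cases i
        exacts [h0, h1, h2]) hS)
      (fun x _ _ h0 h1 h => hout x h0 h1 h) hL hLs

/-! ### Families of equidistant pentagons -/

theorem exists_equidistant_pentagon {r : ℝ} (h1 : 7 / 4 ≤ r) (h2 : r < 2) :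
    ∃ K : Set Plane, IsConvexPentagon K ∧ asymmetryConst K = r ∧ EquidistantToSymmetric K r := by
  have hr : 0 < r := by linarith
  have h : PentagonParam (2 / r) (2 / r / 4) :=
    ⟨by rw [lt_div_iff₀ hr]; linarith, by
      have : 2 / r ≤ 8 / 7 := by rw [div_le_iff₀ hr]; linarith
      linarith, le_rfl⟩
  have e : 2 / (2 / r) = r := by field_simp
  exact ⟨_, h.isConvexPentagon, h.asymmetryConst_pentagon.trans e, by
    have := h.equidistant_pentagon
    rwa [e] at this⟩

theorem exists_continuum_equidistant_pentagons {r : ℝ} (h1 : 7 / 4 < r) (h2 : r < 2) :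
    ∃ F : Set (Set Plane), Cardinal.mk F = Cardinal.continuum ∧
      (∀ K ∈ F, IsConvexPentagon K ∧ asymmetryConst K = r ∧ EquidistantToSymmetric K r) ∧
      F.Pairwise (fun K K' => ¬ AffinelyEquivalent K K') := by
  have hr : 0 < r := by linarith
  have hs : 2 / r < 8 / 7 := by rw [div_lt_iff₀ hr]; linarith
  have h : ∀ τ ∈ Set.Icc (2 * (2 / r - 1)) (2 / r / 4), PentagonParam (2 / r) τ := fun τ hτ =>
    ⟨by rw [lt_div_iff₀ hr]; linarith, hτ.1, hτ.2⟩
  have e : 2 / (2 / r) = r := by field_simp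
  have hinj : Set.InjOn (pentagon (2 / r)) (Set.Icc (2 * (2 / r - 1)) (2 / r / 4)) :=
    fun τ hτ τ' hτ' hE => (h τ hτ).eq_of_affinelyEquivalent (h τ' hτ')
      ⟨AffineEquiv.refl ℝ Plane, by simpa using hE⟩
  refine ⟨pentagon (2 / r) '' Set.Icc (2 * (2 / r - 1)) (2 / r / 4), ?_, ?_, ?_⟩
  · rw [Cardinal.mk_image_eq_of_injOn _ _ hinj, Cardinal.mk_Icc_real (by linarith)]
  · rintro _ ⟨τ, hτ, rfl⟩
    have hE := (h τ hτ).equidistant_pentagon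
    rw [e] at hE
    exact ⟨(h τ hτ).isConvexPentagon, (h τ hτ).asymmetryConst_pentagon.trans e, hE⟩
  · rintro _ ⟨τ, hτ, rfl⟩ _ ⟨τ', hτ', rfl⟩ hne hE
    exact hne (congrArg _ ((h τ hτ).eq_of_affinelyEquivalent (h τ' hτ') hE))

/-! ### The distance between the square and the regular hexagon -/

/-- The estimate behind `ZeroSumPair.abs_det_le`, where `A` and `B` stand for the largest absolute
values in the two triples. The case distinction compares `x` and `y` with a third of `A`. -/
theorem three_mul_sub_le {A B x y s : ℝ} (hB : 0 ≤ B) (hx : 0 ≤ x) (hy : 0 ≤ y) (hAB : B ≤ A)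
    (h1 : A + B - x - y ≤ s) (h2 : B + x ≤ s) (h3 : A + y ≤ s) :
    3 * (A * B - x * y) ≤ 2 * s * A := by
  have hA : 0 ≤ A := hB.trans hAB
  rcases le_total (A / 3) x with hx3 | hx3
  · nlinarith [mul_nonneg hA (sub_nonneg.2 hAB), mul_nonneg hy (sub_nonneg.2 hx3),
      mul_nonneg hA (sub_nonneg.2 h1), mul_nonneg hA (sub_nonneg.2 h2)]
  rcases le_total (A / 3) y with hy3 | hy3
  · nlinarith [mul_nonneg hA (sub_nonneg.2 hAB), mul_nonneg hx (sub_nonneg.2 hy3),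
      mul_nonneg hA (sub_nonneg.2 h1), mul_nonneg hA (sub_nonneg.2 h3)]
  · nlinarith [mul_nonneg hA (sub_nonneg.2 hAB), mul_nonneg (sub_nonneg.2 hx3) (sub_nonneg.2 hy3),
      mul_nonneg hA (sub_nonneg.2 h1), mul_nonneg hA (sub_nonneg.2 hx3),
      mul_nonneg hA (sub_nonneg.2 hy3)]

/-- The estimate of `three_mul_sub_le` without an order between `A` and `B`. -/
theorem three_mul_sub_le' {A B x y s R : ℝ} (hA : 0 ≤ A) (hB : 0 ≤ B) (hx : 0 ≤ x) (hy : 0 ≤ y)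
    (hAR : A ≤ R) (hBR : B ≤ R) (h1 : A + B - x - y ≤ s) (h2 : B + x ≤ s) (h3 : A + y ≤ s) :
    3 * (A * B - x * y) ≤ 2 * s * R := by
  have hs : 0 ≤ s := by linarith
  rcases le_total B A with h | h
  · have := three_mul_sub_le hB hx hy h h1 h2 h3
    nlinarith
  · have := three_mul_sub_le hA hy hx h (by linarith) h3 h2
    nlinarith

/-- Two zero-sum triples with entries at most `R` and with columns of `ℓ¹`-norm at most `s`. -/
structure ZeroSumPair (a₁ a₂ a₃ b₁ b₂ b₃ s R : ℝ) : Prop where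
  sum_a : a₁ + a₂ + a₃ = 0
  sum_b : b₁ + b₂ + b₃ = 0
  col₁ : |a₁| + |b₁| ≤ s
  col₂ : |a₂| + |b₂| ≤ s
  col₃ : |a₃| + |b₃| ≤ s
  a₁_le : |a₁| ≤ R
  a₂_le : |a₂| ≤ R
  a₃_le : |a₃| ≤ R
  b₁_le : |b₁| ≤ R
  b₂_le : |b₂| ≤ R
  b₃_le : |b₃| ≤ R

namespace ZeroSumPair

variable {a₁ a₂ a₃ b₁ b₂ b₃ s R : ℝ}

theorem rotate (h : ZeroSumPair a₁ a₂ a₃ b₁ b₂ b₃ s R) : ZeroSumPair a₂ a₃ a₁ b₂ b₃ b₁ s R :=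
  ⟨by linarith [h.sum_a], by linarith [h.sum_b], h.col₂, h.col₃, h.col₁, h.a₂_le, h.a₃_le, h.a₁_le,
    h.b₂_le, h.b₃_le, h.b₁_le⟩

theorem swap (h : ZeroSumPair a₁ a₂ a₃ b₁ b₂ b₃ s R) : ZeroSumPair a₂ a₁ a₃ b₂ b₁ b₃ s R :=
  ⟨by linarith [h.sum_a], by linarith [h.sum_b], h.col₂, h.col₁, h.col₃, h.a₂_le, h.a₁_le, h.a₃_le,
    h.b₂_le, h.b₁_le, h.b₃_le⟩

theorem neg_left (h : ZeroSumPair a₁ a₂ a₃ b₁ b₂ b₃ s R) :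
    ZeroSumPair (-a₁) (-a₂) (-a₃) b₁ b₂ b₃ s R := by
  constructor <;> (try simp only [abs_neg]) <;> first | exact h.1 | (cases h; linarith)

theorem neg_right (h : ZeroSumPair a₁ a₂ a₃ b₁ b₂ b₃ s R) :
    ZeroSumPair a₁ a₂ a₃ (-b₁) (-b₂) (-b₃) s R := by
  constructor <;> (try simp only [abs_neg]) <;> first | exact h.1 | (cases h; linarith)

theorem det_le_of_same_sign (h : ZeroSumPair a₁ a₂ a₃ b₁ b₂ b₃ s R) (ha₁ : 0 ≤ a₁) (ha₂ : 0 ≤ a₂)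
    (hb₁ : 0 ≤ b₁) (hb₂ : 0 ≤ b₂) : 3 * (a₁ * b₂ - a₂ * b₁) ≤ 2 * s * R := by
  have e1 := h.a₁_le
  have e2 := h.b₂_le
  have e3 := h.col₃
  have e4 := h.sum_a
  have e5 := h.sum_b
  rw [abs_of_nonneg ha₁] at e1
  rw [abs_of_nonneg hb₂] at e2
  rw [abs_of_nonpos (by linarith), abs_of_nonpos (by linarith)] at e3
  nlinarith [mul_nonneg ha₂ hb₁, mul_nonneg ha₁ hb₂, sq_nonneg (a₁ - b₂)]

theorem abs_det_le_of_opposite_sign (h : ZeroSumPair a₁ a₂ a₃ b₁ b₂ b₃ s R) (ha₁ : 0 ≤ a₁)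
    (ha₂ : 0 ≤ a₂) (hb₁ : 0 ≤ b₁) (hb₂ : b₂ ≤ 0) (hb₃ : 0 ≤ b₃) :
    3 * |a₁ * b₂ - a₂ * b₁| ≤ 2 * s * R := by
  have e1 := h.col₁
  have e2 := h.col₂
  have e3 := h.col₃
  have e4 := h.sum_a
  have e5 := h.sum_b
  have e6 := h.a₃_le
  have e7 := h.b₂_le
  rw [abs_of_nonneg ha₁, abs_of_nonneg hb₁] at e1
  rw [abs_of_nonneg ha₂, abs_of_nonpos hb₂] at e2
  rw [abs_of_nonpos (by linarith), abs_of_nonneg hb₃] at e3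
  rw [abs_of_nonpos (by linarith)] at e6
  rw [abs_of_nonpos hb₂] at e7
  have := three_mul_sub_le' (A := a₁ + a₂) (B := -b₂) (x := a₂) (y := b₃) (s := s) (R := R)
    (by linarith) (by linarith) ha₂ hb₃ (by linarith) e7 (by linarith) (by linarith) (by linarith)
  rw [abs_of_nonpos (by nlinarith)]
  obtain rfl : b₁ = -b₂ - b₃ := by linarith
  linarith

theorem abs_det_le_of_nonneg (h : ZeroSumPair a₁ a₂ a₃ b₁ b₂ b₃ s R) (ha₁ : 0 ≤ a₁)
    (ha₂ : 0 ≤ a₂) : 3 * |a₁ * b₂ - a₂ * b₁| ≤ 2 * s * R := by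
  have key : ∀ {b₁ b₂ b₃ : ℝ}, ZeroSumPair a₁ a₂ a₃ b₁ b₂ b₃ s R → 0 ≤ b₁ →
      3 * |a₁ * b₂ - a₂ * b₁| ≤ 2 * s * R := by
    intro b₁ b₂ b₃ h hb₁
    have e := h.sum_b
    rcases le_total 0 b₂ with hb₂ | hb₂
    · rcases abs_cases (a₁ * b₂ - a₂ * b₁) with ⟨h1, -⟩ | ⟨h1, -⟩ <;> rw [h1]
      · exact h.det_le_of_same_sign ha₁ ha₂ hb₁ hb₂
      · have := h.swap.det_le_of_same_sign ha₂ ha₁ hb₂ hb₁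
        linarith
    · rcases le_total 0 b₃ with hb₃ | hb₃
      · exact h.abs_det_le_of_opposite_sign ha₁ ha₂ hb₁ hb₂ hb₃
      · have := h.neg_right.swap.abs_det_le_of_opposite_sign ha₂ ha₁ (by linarith) (by linarith)
          (by linarith)
        rw [show a₂ * -b₁ - a₁ * -b₂ = a₁ * b₂ - a₂ * b₁ by ring] at this
        exact this
  rcases le_total 0 b₁ with hb | hb
  · exact key h hb
  · have := key h.neg_right (by linarith)
    rw [show a₁ * -b₂ - a₂ * -b₁ = -(a₁ * b₂ - a₂ * b₁) by ring, abs_neg] at this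
    exact this

/-- The `2 × 2` minor of two zero-sum triples. -/
theorem abs_det_le (h : ZeroSumPair a₁ a₂ a₃ b₁ b₂ b₃ s R) :
    3 * |a₁ * b₂ - a₂ * b₁| ≤ 2 * s * R := by
  -- two of the three entries of `a` have the same sign, and all three minors agree
  have e23 : a₂ * b₃ - a₃ * b₂ = a₁ * b₂ - a₂ * b₁ := by
    linear_combination a₂ * h.sum_b - b₂ * h.sum_a
  have e31 : a₃ * b₁ - a₁ * b₃ = a₁ * b₂ - a₂ * b₁ := by
    linear_combination b₁ * h.sum_a - a₁ * h.sum_b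
  have key : ∀ {a₁ a₂ a₃ b₁ b₂ b₃ : ℝ}, ZeroSumPair a₁ a₂ a₃ b₁ b₂ b₃ s R → a₁ ≤ 0 → a₂ ≤ 0 →
      3 * |a₁ * b₂ - a₂ * b₁| ≤ 2 * s * R := by
    intro a₁ a₂ a₃ b₁ b₂ b₃ h h1 h2
    have := h.neg_left.abs_det_le_of_nonneg (by linarith) (by linarith)
    rw [show -a₁ * b₂ - -a₂ * b₁ = -(a₁ * b₂ - a₂ * b₁) by ring, abs_neg] at this
    exact this
  rcases le_total 0 a₁ with h1 | h1 <;> rcases le_total 0 a₂ with h2 | h2 <;>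
    rcases le_total 0 a₃ with h3 | h3
  · exact h.abs_det_le_of_nonneg h1 h2
  · exact h.abs_det_le_of_nonneg h1 h2
  · exact e31 ▸ h.rotate.rotate.abs_det_le_of_nonneg h3 h1
  · exact e23 ▸ key h.rotate h2 h3
  · exact e23 ▸ h.rotate.abs_det_le_of_nonneg h2 h3
  · exact e31 ▸ key h.rotate.rotate h3 h1
  · exact key h h1 h2
  · exact key h h1 h2

end ZeroSumPair

/-- The square `[-1, 1]²`. -/
def unitSquare : Set Plane := {x | |x 0| ≤ 1 ∧ |x 1| ≤ 1}

/-- An affine image of the regular hexagon. -/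
def unitHexagon : Set Plane := {x | |x 0| ≤ 1 ∧ |x 1| ≤ 1 ∧ |x 0 + x 1| ≤ 1}

/-- Composing one half of a sandwich around `A` with one half of a sandwich around `B`. The
translations cancel in the half difference of the images of `y` and `-y`. -/
theorem exists_half_sub_mem {K A B : Set Plane} {r : ℝ} {h₁ h₂ : Plane ≃ₗ[ℝ] Plane}
    {p₁ w₁ p₂ : Plane} (hA : ∀ y ∈ A, ∃ k ∈ K, y = h₁ (r • k + w₁) + p₁)
    (hneg : ∀ y ∈ A, -y ∈ A) (hB : ∀ k ∈ K, h₂ k + p₂ ∈ B) {y : Plane} (hy : y ∈ A) :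
    ∃ a ∈ B, ∃ b ∈ B, h₂ (h₁.symm y) = (r / 2) • (a - b) := by
  obtain ⟨k, hk, e⟩ := hA y hy
  obtain ⟨l, hl, e'⟩ := hA _ (hneg y hy)
  refine ⟨_, hB k hk, _, hB l hl, ?_⟩
  have h3 : y = h₁ ((r / 2) • (k - l)) := by
    have : (2 : ℝ) • y = (2 : ℝ) • h₁ ((r / 2) • (k - l)) := by
      simp only [map_add, map_sub, map_smul] at e e' ⊢
      linear_combination (norm := module) e - e'
    exact smul_right_injective _ (two_ne_zero (α := ℝ)) this
  rw [h3, LinearEquiv.symm_apply_apply]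
  simp only [map_sub, map_smul]
  module

theorem abs_half_sub_le {r a b : ℝ} (hr : 0 ≤ r) (ha : |a| ≤ 1) (hb : |b| ≤ 1) :
    |r / 2 * (a - b)| ≤ r := by
  rw [abs_mul, abs_of_nonneg (by positivity : 0 ≤ r / 2)]
  nlinarith [abs_sub a b]

/-- The square and the regular hexagon have Banach-Mazur distance at least `3/2`, and distances
multiply along a body `K`. If `g` is the linear map from the square to the hexagon, then the images
`u`, `v` of the basis vectors, completed to zero-sum triples, satisfy `|uᵢ| + |vᵢ| ≤ r₁` because `g`
maps the square into `r₁` times the hexagon, and their entries are at most `r₂ |det g|` because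
`g⁻¹` maps the hexagon into `r₂` times the square. -/
theorem three_halves_le_mul {K : Set Plane} {r₁ r₂ : ℝ} (hr₁ : 0 < r₁) (hr₂ : 0 < r₂)
    (hS : HasAffineSandwich K unitSquare r₁) (hH : HasAffineSandwich K unitHexagon r₂) :
    3 / 2 ≤ r₁ * r₂ := by
  obtain ⟨h₁, p₁, w₁, hS1, hS2⟩ := hS
  obtain ⟨h₂, p₂, w₂, hH1, hH2⟩ := hH
  let g : Plane ≃ₗ[ℝ] Plane := h₁.symm.trans h₂
  have hg : ∀ y ∈ unitSquare, |g y 0| ≤ r₁ ∧ |g y 1| ≤ r₁ ∧ |g y 0 + g y 1| ≤ r₁ := by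
    intro y hy
    obtain ⟨a, ⟨ha0, ha1, ha2⟩, b, ⟨hb0, hb1, hb2⟩, e⟩ := exists_half_sub_mem hS2
      (fun y hy => by simpa [unitSquare] using hy) hH1 hy
    have e' : g y = (r₁ / 2) • (a - b) := e
    rw [e']
    simp only [PiLp.smul_apply, PiLp.sub_apply, smul_eq_mul]
    refine ⟨abs_half_sub_le hr₁.le ha0 hb0, abs_half_sub_le hr₁.le ha1 hb1, ?_⟩
    rw [show r₁ / 2 * (a 0 - b 0) + r₁ / 2 * (a 1 - b 1) =
      r₁ / 2 * ((a 0 + a 1) - (b 0 + b 1)) by ring]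
    exact abs_half_sub_le hr₁.le ha2 hb2
  have hg' : ∀ y ∈ unitHexagon, |g.symm y 0| ≤ r₂ ∧ |g.symm y 1| ≤ r₂ := by
    intro y hy
    obtain ⟨a, ⟨ha0, ha1⟩, b, ⟨hb0, hb1⟩, e⟩ := exists_half_sub_mem hH2
      (fun y ⟨h0, h1, h2⟩ => ⟨by simpa using h0, by simpa using h1, by
        rw [PiLp.neg_apply, PiLp.neg_apply, ← neg_add, abs_neg]; exact h2⟩) hS1 hy
    have e' : g.symm y = (r₂ / 2) • (a - b) := e
    rw [e']
    simp only [PiLp.smul_apply, PiLp.sub_apply, smul_eq_mul]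
    exact ⟨abs_half_sub_le hr₂.le ha0 hb0, abs_half_sub_le hr₂.le ha1 hb1⟩
  set u := g !₂[1, 0] with hu
  set v := g !₂[0, 1] with hv
  have hlin : ∀ x, g x = x 0 • u + x 1 • v := by
    intro x
    have h2 : x = x 0 • !₂[1, 0] + x 1 • !₂[0, 1] := by
      ext i; fin_cases i <;> simp
    conv_lhs => rw [h2]
    rw [map_add, map_smul, map_smul]
  set D := u 0 * v 1 - u 1 * v 0 with hD
  -- Cramer's rule
  have hinv : ∀ x : Plane, D * g.symm x 0 = v 1 * x 0 - v 0 * x 1 ∧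
      D * g.symm x 1 = u 0 * x 1 - u 1 * x 0 := by
    intro x
    have h1 := hlin (g.symm x)
    rw [LinearEquiv.apply_symm_apply] at h1
    have h10 := congrArg (fun z : Plane => z 0) h1
    have h11 := congrArg (fun z : Plane => z 1) h1
    simp at h10 h11
    constructor
    · rw [hD]; linear_combination -v 1 * h10 + v 0 * h11
    · rw [hD]; linear_combination -u 0 * h11 + u 1 * h10
  have hinv' : ∀ x ∈ unitHexagon, |v 1 * x 0 - v 0 * x 1| ≤ |D| * r₂ ∧
      |u 0 * x 1 - u 1 * x 0| ≤ |D| * r₂ := by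
    intro x hx
    obtain ⟨b0, b1⟩ := hg' x hx
    rw [← (hinv x).1, ← (hinv x).2, abs_mul, abs_mul]
    exact ⟨mul_le_mul_of_nonneg_left b0 (abs_nonneg _),
      mul_le_mul_of_nonneg_left b1 (abs_nonneg _)⟩
  have c1 := hinv' !₂[1, 0] (by simp [unitHexagon])
  have c2 := hinv' !₂[0, 1] (by simp [unitHexagon])
  have c3 := hinv' !₂[1, -1] (by simp [unitHexagon])
  have d1 := hg !₂[1, 1] (by simp [unitSquare])
  have d2 := hg !₂[1, -1] (by simp [unitSquare])
  rw [hlin] at d1 d2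
  simp at c1 c2 c3 d1 d2
  have habs : ∀ a b : ℝ, |a + b| ≤ r₁ → |a + -b| ≤ r₁ → |a| + |b| ≤ r₁ := by
    intro a b h1 h2
    rw [abs_le] at h1 h2
    rcases abs_cases a with ⟨h, -⟩ | ⟨h, -⟩ <;> rcases abs_cases b with ⟨h', -⟩ | ⟨h', -⟩ <;>
      rw [h, h'] <;> linarith
  have hD0 : D ≠ 0 := by
    intro h0
    rw [h0, abs_zero, zero_mul] at c1 c2
    have u0 : u 0 = 0 := abs_nonpos_iff.mp c2.2
    have u1 : u 1 = 0 := abs_nonpos_iff.mp c1.2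
    have : u = 0 := by ext i; fin_cases i <;> simpa
    rw [hu] at this
    have h3 := congrArg (fun z : Plane => z 0) (g.map_eq_zero_iff.mp this)
    simp at h3
  have hpair : ZeroSumPair (u 0) (u 1) (-(u 0 + u 1)) (v 0) (v 1) (-(v 0 + v 1)) r₁ (|D| * r₂) := by
    refine ⟨by ring, by ring, habs _ _ d1.1 d2.1, habs _ _ d1.2.1 d2.2.1, ?_, c2.2, c1.2, ?_, c2.1,
      c1.1, ?_⟩
    · rw [abs_neg, abs_neg]
      refine habs _ _ ?_ ?_
      · rw [show u 0 + u 1 + (v 0 + v 1) = u 0 + v 0 + (u 1 + v 1) by ring]; exact d1.2.2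
      · rw [show u 0 + u 1 + -(v 0 + v 1) = u 0 + -v 0 + (u 1 + -v 1) by ring]; exact d2.2.2
    · rw [show -(u 0 + u 1) = -u 0 - u 1 by ring]; exact c3.2
    · rw [abs_neg, show v 0 + v 1 = v 1 + v 0 by ring]; exact c3.1
  have := hpair.abs_det_le
  rw [← hD] at this
  have hDpos : 0 < |D| := abs_pos.mpr hD0
  nlinarith

/-! ### Distances to the square and to the hexagon -/

theorem mem_unitSquare {x : Plane} : x ∈ unitSquare ↔ ∀ i, |x i| ≤ 1 := by
  simp [unitSquare, Fin.forall_fin_two]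

theorem zero_mem_interior_of_hexagon_subset {S : Set Plane} (hS : unitHexagon ⊆ S) :
    (0 : Plane) ∈ interior S := by
  refine mem_interior.mpr ⟨{x : Plane | |x 0| < 1 / 2 ∧ |x 1| < 1 / 2}, ?_, ?_, by simp⟩
  · rintro x ⟨h0, h1⟩
    refine hS ⟨by linarith, by linarith, ?_⟩
    have := abs_add_le (x 0) (x 1)
    linarith
  · exact IsOpen.and (isOpen_lt (by fun_prop) (by fun_prop))
      (isOpen_lt (by fun_prop) (by fun_prop))

theorem convex_abs_le (f : Plane →ₗ[ℝ] ℝ) : Convex ℝ {x | |f x| ≤ 1} := by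
  intro x hx y hy a b ha hb hab
  simp only [Set.mem_ofPred_eq, abs_le, map_add, map_smul, smul_eq_mul] at hx hy ⊢
  obtain rfl : b = 1 - a := by linarith
  constructor <;> nlinarith

theorem isConvexBody_unitSquare : IsConvexBody unitSquare := by
  refine ⟨?_, ?_, 0, zero_mem_interior_of_hexagon_subset fun x h => ⟨h.1, h.2.1⟩⟩
  · exact (convex_abs_le (EuclideanSpace.proj (0 : Fin 2) : Plane →L[ℝ] ℝ).toLinearMap).inter
      (convex_abs_le (EuclideanSpace.proj (1 : Fin 2) : Plane →L[ℝ] ℝ).toLinearMap)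
  · refine Metric.isCompact_of_isClosed_isBounded ?_ ?_
    · have c0 : IsClosed {x : Plane | |x 0| ≤ 1} := isClosed_le (by fun_prop) (by fun_prop)
      have c1 : IsClosed {x : Plane | |x 1| ≤ 1} := isClosed_le (by fun_prop) (by fun_prop)
      exact c0.inter c1
    · refine (Metric.isBounded_closedBall (x := (0 : Plane)) (r := 2)).subset fun x hx => ?_
      rw [mem_closedBall_zero_iff, EuclideanSpace.norm_eq, Real.sqrt_le_left (by norm_num),
        Fin.sum_univ_two, Real.norm_eq_abs, Real.norm_eq_abs]
      have h0 := hx.1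
      have h1 := hx.2
      nlinarith [abs_nonneg (x 0), abs_nonneg (x 1)]

theorem isConvexBody_unitHexagon : IsConvexBody unitHexagon := by
  refine ⟨?_, ?_, 0, zero_mem_interior_of_hexagon_subset subset_rfl⟩
  · exact (convex_abs_le (EuclideanSpace.proj (0 : Fin 2) : Plane →L[ℝ] ℝ).toLinearMap).inter
      ((convex_abs_le (EuclideanSpace.proj (1 : Fin 2) : Plane →L[ℝ] ℝ).toLinearMap).inter
      (convex_abs_le ((EuclideanSpace.proj (0 : Fin 2) : Plane →L[ℝ] ℝ).toLinearMap +
        (EuclideanSpace.proj (1 : Fin 2) : Plane →L[ℝ] ℝ).toLinearMap)))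
  · refine isConvexBody_unitSquare.2.1.of_isClosed_subset ?_ fun x h => ⟨h.1, h.2.1⟩
    have c0 : IsClosed {x : Plane | |x 0| ≤ 1} := isClosed_le (by fun_prop) (by fun_prop)
    have c1 : IsClosed {x : Plane | |x 1| ≤ 1} := isClosed_le (by fun_prop) (by fun_prop)
    have c2 : IsClosed {x : Plane | |x 0 + x 1| ≤ 1} := isClosed_le (by fun_prop) (by fun_prop)
    exact c0.inter (c1.inter c2)

theorem neg_mem_unitSquare {x : Plane} (hx : x ∈ unitSquare) : -x ∈ unitSquare := by
  simpa [unitSquare] using hx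

theorem isCentrallySymmetric_unitSquare : IsCentrallySymmetric unitSquare :=
  ⟨0, fun x hx => by simpa using neg_mem_unitSquare hx⟩

theorem isCentrallySymmetric_unitHexagon : IsCentrallySymmetric unitHexagon :=
  ⟨0, fun x ⟨h0, h1, h2⟩ => ⟨by simpa using h0, by simpa using h1, by
    rw [smul_zero, zero_sub, PiLp.neg_apply, PiLp.neg_apply, ← neg_add, abs_neg]; exact h2⟩⟩

/-- Any two convex bodies have some sandwich, so that the infimum in the definition of the
Banach-Mazur distance is one over a nonempty set. -/
theorem banachMazurSet_nonempty {K L : Set Plane} (hK : IsConvexBody K) (hL : IsConvexBody L) :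
    (banachMazurSet K L).Nonempty := by
  obtain ⟨k, hk⟩ := hK.2.2
  obtain ⟨δ, hδ, hkb⟩ := Metric.mem_nhds_iff.mp (mem_interior_iff_mem_nhds.mp hk)
  obtain ⟨b, hb⟩ := hL.2.2
  obtain ⟨ε, hε, hbb⟩ := Metric.mem_nhds_iff.mp (mem_interior_iff_mem_nhds.mp hb)
  obtain ⟨R, hR0, hR⟩ := hK.2.1.isBounded.exists_pos_norm_le
  obtain ⟨R', hR0', hR'⟩ := hL.2.1.isBounded.exists_pos_norm_le
  set η : ℝ := ε / (2 * R) with hη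
  have hη0 : 0 < η := by positivity
  set q : ℝ := (R' + ‖b‖) / (η * δ) with hq
  have hq0 : 0 < q := by positivity
  refine ⟨1 + q, mem_banachMazurSet (by linarith) ⟨LinearEquiv.smulOfNeZero ℝ Plane η hη0.ne', b,
    -((1 + q) • k), fun x hx => hbb ?_, fun y hy =>
      ⟨k + ((1 + q) * η)⁻¹ • (y - b), hkb ?_, ?_⟩⟩⟩
  · rw [Metric.mem_ball, dist_eq_norm, add_sub_cancel_right, LinearEquiv.smulOfNeZero_apply,
      norm_smul, Real.norm_of_nonneg hη0.le]
    calc η * ‖x‖ ≤ η * R := by gcongr; exact hR x hx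
      _ = ε / 2 := by rw [hη]; field_simp
      _ < ε := by linarith
  · have h1 : 0 < (1 + q) * η := by positivity
    rw [Metric.mem_ball, dist_eq_norm, add_sub_cancel_left, norm_smul,
      Real.norm_of_nonneg (inv_nonneg.mpr h1.le), inv_mul_lt_iff₀ h1]
    have h2 : ‖y - b‖ ≤ R' + ‖b‖ := (norm_sub_le _ _).trans (by gcongr; exact hR' y hy)
    have h3 : q * (η * δ) = R' + ‖b‖ := div_mul_cancel₀ _ (by positivity)
    nlinarith [mul_pos hη0 hδ]
  · have h1 : (1 + q) * η ≠ 0 := by positivity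
    have h2 : η • ((1 + q) • (((1 + q) * η)⁻¹ • (y - b))) = y - b := by
      rw [smul_smul, smul_smul, show η * (1 + q) * ((1 + q) * η)⁻¹ = 1 by field_simp, one_smul]
    rw [LinearEquiv.smulOfNeZero_apply]
    linear_combination (norm := module) -h2

theorem EquidistantToSymmetric.exists_sandwich_lt {K L : Set Plane} {r t : ℝ}
    (hE : EquidistantToSymmetric K r) (hK : IsConvexBody K) (hL : IsConvexBody L)
    (hLs : IsCentrallySymmetric L) (ht : r < t) :
    ∃ r', r ≤ r' ∧ 0 < r' ∧ r' < t ∧ HasAffineSandwich K L r' := by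
  have h := hE L hL hLs
  rw [banachMazurDist_eq_sInf] at h
  obtain ⟨r', hr', hlt⟩ := exists_lt_of_csInf_lt (banachMazurSet_nonempty hK hL) (h ▸ ht)
  exact ⟨r', h ▸ csInf_le (bddBelow_banachMazurSet K L) hr', hr'.1, hlt,
    hasAffineSandwich_of_mem hr'⟩

theorem EquidistantToSymmetric.nonneg {K : Set Plane} {r : ℝ} (hE : EquidistantToSymmetric K r) :
    0 ≤ r := by
  rw [← hE _ isConvexBody_unitSquare isCentrallySymmetric_unitSquare]
  exact Real.sInf_nonneg fun x hx => hx.1.le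

/-- A body at distance `r` to both the square and the hexagon puts them at distance at most `r²`. -/
theorem EquidistantToSymmetric.sqrt_le {K : Set Plane} {r : ℝ} (hE : EquidistantToSymmetric K r)
    (hK : IsConvexBody K) : Real.sqrt (3 / 2) ≤ r := by
  have h0 := hE.nonneg
  refine le_of_forall_gt_imp_ge_of_dense fun t ht => ?_
  obtain ⟨r₁, -, h1, h1', hS⟩ := hE.exists_sandwich_lt hK isConvexBody_unitSquare
    isCentrallySymmetric_unitSquare ht
  obtain ⟨r₂, -, h2, h2', hH⟩ := hE.exists_sandwich_lt hK isConvexBody_unitHexagon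
    isCentrallySymmetric_unitHexagon ht
  have := three_halves_le_mul h1 h2 hS hH
  rw [Real.sqrt_le_left (by linarith)]
  nlinarith

/-- The distance of `K` to the symmetric body `(K - z) ∩ (z - K)`, for a suitable center `z`, is at
most the asymmetry of `K`. -/
theorem EquidistantToSymmetric.le_of_isAsymmetryBound {K : Set Plane} {r t : ℝ}
    (hE : EquidistantToSymmetric K r) (hK : IsConvexBody K) (ht : 1 < t)
    (hb : IsAsymmetryBound K t) : r ≤ t := by
  obtain ⟨ht0, c, hc⟩ := hb
  have hz := mem_interior_of_asymmetry hK.1 hK.2.2 ht0 hc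
  have hcz : c = (1 + t) • (1 + t)⁻¹ • c := by
    rw [smul_smul, mul_inv_cancel₀ (by positivity), one_smul]
  set z := (1 + t)⁻¹ • c with hzdef
  clear_value z
  subst hcz
  set L : Set Plane := K ∩ {x | (2 : ℝ) • z - x ∈ K} with hL
  have hcont : Continuous fun x : Plane => (2 : ℝ) • z - x := by fun_prop
  have hLb : IsConvexBody L := by
    refine ⟨hK.1.inter ?_, hK.2.1.inter_right (hK.2.1.isClosed.preimage hcont), z, ?_⟩
    · intro x hx y hy a b ha hb hab
      have := hK.1 hx hy ha hb hab
      have e : (2 : ℝ) • z - (a • x + b • y) =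
          a • ((2 : ℝ) • z - x) + b • ((2 : ℝ) • z - y) := by
        obtain rfl : b = 1 - a := by linarith
        module
      rw [Set.mem_ofPred_eq, e]; exact this
    · rw [hL, interior_inter]
      refine ⟨hz, mem_interior.mpr ⟨{x | (2 : ℝ) • z - x ∈ interior K}, fun x hx =>
        interior_subset (s := K) hx, isOpen_interior.preimage hcont, ?_⟩⟩
      rw [Set.mem_ofPred_eq, two_smul, add_sub_cancel_right]; exact hz
  have hLs : IsCentrallySymmetric L := ⟨z, fun x hx => ⟨hx.2, by
    rw [Set.mem_ofPred_eq, sub_sub_cancel]; exact hx.1⟩⟩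
  rw [← hE L hLb hLs]
  have hzK := interior_subset hz
  have htt : t * t⁻¹ = 1 := mul_inv_cancel₀ ht0.ne'
  refine banachMazurDist_le ht ⟨LinearEquiv.smulOfNeZero ℝ Plane t⁻¹ (inv_ne_zero ht0.ne'),
    z - t⁻¹ • z, z - t • z, fun x hx => ⟨?_, ?_⟩, fun y hy => ⟨y, hy.1, ?_⟩⟩
  · have hc : Convex ℝ K := hK.1
    have := hc hx hzK (a := t⁻¹) (b := 1 - t⁻¹) (by positivity)
      (sub_nonneg.mpr (inv_le_one_of_one_le₀ ht.le)) (by ring)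
    convert this using 1
    rw [LinearEquiv.smulOfNeZero_apply]; module
  · obtain ⟨y, hy, rfl⟩ := hc x hx
    rw [Set.mem_ofPred_eq, LinearEquiv.smulOfNeZero_apply]
    convert hy using 1
    linear_combination (norm := module) htt • (y - z)
  · rw [LinearEquiv.smulOfNeZero_apply]
    linear_combination (norm := module) htt • (z - y)

/-! ### The distance to the square is attained -/

theorem norm_le_of_norm_le_on_ball {E F : Type*} [NormedAddCommGroup E] [NormedSpace ℝ E]
    [NormedAddCommGroup F] [NormedSpace ℝ F] (f : E →L[ℝ] F) {δ C : ℝ} (hδ : 0 < δ) (hC : 0 ≤ C)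
    (h : ∀ x, ‖x‖ ≤ δ → ‖f x‖ ≤ C) : ‖f‖ ≤ C / δ := by
  refine f.opNorm_le_bound (by positivity) fun x => ?_
  rcases eq_or_ne x 0 with rfl | hx
  · simp
  have hx' : 0 < ‖x‖ := norm_pos_iff.mpr hx
  have := h ((δ / ‖x‖) • x) (by
    rw [norm_smul, Real.norm_of_nonneg (by positivity)]; field_simp; exact le_rfl)
  rw [map_smul, norm_smul, Real.norm_of_nonneg (by positivity)] at this
  rw [div_mul_eq_mul_div, le_div_iff₀ hδ]
  rw [div_mul_eq_mul_div, div_le_iff₀ hx'] at this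
  linarith

/-- The infimum in the distance to the square is attained. Along a minimizing sequence of sandwiches
the linear maps are bounded, because `K` contains a disc, and the limit map is invertible, because
the square is covered by it. -/
theorem EquidistantToSymmetric.hasAffineSandwich_unitSquare {K : Set Plane} {r : ℝ}
    (hE : EquidistantToSymmetric K r) (hK : IsConvexBody K) :
    HasAffineSandwich K unitSquare r := by
  have hseq : ∀ n : ℕ, ∃ (t : ℝ) (H : Plane →L[ℝ] Plane) (p W : Plane),
      r ≤ t ∧ t < r + 1 / (n + 1) ∧ (∀ k ∈ K, H k + p ∈ unitSquare) ∧
      ∀ y ∈ unitSquare, ∃ k ∈ K, y = t • H k + W := by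
    intro n
    obtain ⟨t, h1, -, h2, h, p, w, h3, h4⟩ := hE.exists_sandwich_lt hK isConvexBody_unitSquare
      isCentrallySymmetric_unitSquare (lt_add_of_pos_right r (Nat.one_div_pos_of_nat (n := n)))
    refine ⟨t, LinearMap.toContinuousLinearMap h.toLinearMap, p, h w + p, h1, h2, h3,
      fun y hy => ?_⟩
    obtain ⟨k, hk, e⟩ := h4 y hy
    refine ⟨k, hk, ?_⟩
    rw [e, map_add, map_smul, add_assoc]; rfl
  choose t H p W ht1 ht2 hin hout using hseq
  obtain ⟨z, hz⟩ := hK.2.2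
  obtain ⟨δ, hδ, hzb⟩ := Metric.nhds_basis_closedBall.mem_iff.mp (mem_interior_iff_mem_nhds.mp hz)
  obtain ⟨R, hR0, hR⟩ := hK.2.1.isBounded.exists_pos_norm_le
  obtain ⟨C, hC0, hC⟩ := isConvexBody_unitSquare.2.1.isBounded.exists_pos_norm_le
  have hzK := interior_subset hz
  have hH : ∀ n, ‖H n‖ ≤ 2 * C / δ := fun n => by
    refine norm_le_of_norm_le_on_ball _ hδ (by positivity) fun x hx => ?_
    have h1 := hC _ (hin n _ (hzb (show z + x ∈ Metric.closedBall z δ by simpa using hx)))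
    have h2 := hC _ (hin n _ hzK)
    have h3 : H n x = (H n (z + x) + p n) - (H n z + p n) := by rw [map_add]; abel
    rw [h3]
    exact (norm_sub_le _ _).trans (by linarith)
  have hp : ∀ n, ‖p n‖ ≤ C + 2 * C / δ * R := fun n => by
    have h1 := hC _ (hin n _ hzK)
    have h2 : ‖H n z‖ ≤ 2 * C / δ * R := (H n).le_of_opNorm_le_of_le (hH n) (hR z hzK)
    rw [← add_sub_cancel_left (H n z) (p n)]
    exact (norm_sub_le _ _).trans (by linarith)
  have hr0 := hE.nonneg
  have ht3 : ∀ n, t n ≤ r + 1 := fun n => (ht2 n).le.trans (by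
    gcongr
    rw [div_le_one (by positivity)]
    linarith [(Nat.cast_nonneg n : (0 : ℝ) ≤ n)])
  have hW : ∀ n, ‖W n‖ ≤ (r + 1) * (2 * C / δ * R) := fun n => by
    obtain ⟨k, hk, e⟩ := hout n 0 (by simp [unitSquare])
    have h1 : W n = -(t n • H n k) := by rw [eq_neg_iff_add_eq_zero, add_comm]; exact e.symm
    rw [h1, norm_neg, norm_smul, Real.norm_of_nonneg (hr0.trans (ht1 n))]
    have h2 : ‖H n k‖ ≤ 2 * C / δ * R := (H n).le_of_opNorm_le_of_le (hH n) (hR k hk)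
    exact mul_le_mul (ht3 n) h2 (norm_nonneg _) (by linarith)
  obtain ⟨⟨H', p', W'⟩, -, φ, hφ, hlim⟩ := tendsto_subseq_of_bounded
    (s := Metric.closedBall (0 : Plane →L[ℝ] Plane) (2 * C / δ) ×ˢ
      (Metric.closedBall (0 : Plane) (C + 2 * C / δ * R) ×ˢ
      Metric.closedBall (0 : Plane) ((r + 1) * (2 * C / δ * R))))
    (Metric.isBounded_closedBall.prod (Metric.isBounded_closedBall.prod
      Metric.isBounded_closedBall)) (x := fun n => (H n, p n, W n))
    (fun n => ⟨by simpa using hH n, by simpa using hp n, by simpa using hW n⟩)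
  have hlH : Tendsto (fun n => H (φ n)) atTop (𝓝 H') := (continuous_fst.tendsto _).comp hlim
  have hlp : Tendsto (fun n => p (φ n)) atTop (𝓝 p') :=
    ((continuous_fst.comp continuous_snd).tendsto _).comp hlim
  have hlW : Tendsto (fun n => W (φ n)) atTop (𝓝 W') :=
    ((continuous_snd.comp continuous_snd).tendsto _).comp hlim
  have hlt : Tendsto t atTop (𝓝 r) := by
    refine tendsto_of_tendsto_of_tendsto_of_le_of_le tendsto_const_nhds ?_ ht1
      (fun n => (ht2 n).le)
    simpa using tendsto_one_div_add_atTop_nhds_zero_nat.const_add r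
  have hlt' := hlt.comp hφ.tendsto_atTop
  have happ : ∀ {G : ℕ → Plane →L[ℝ] Plane} {x : ℕ → Plane} {x' : Plane},
      Tendsto G atTop (𝓝 H') → Tendsto x atTop (𝓝 x') →
      Tendsto (fun n => G n (x n)) atTop (𝓝 (H' x')) := fun {G x x'} hG hx =>
    (isBoundedBilinearMap_apply.continuous.tendsto (H', x')).comp (hG.prodMk_nhds hx)
  have hin' : ∀ k ∈ K, H' k + p' ∈ unitSquare := fun k hk =>
    isConvexBody_unitSquare.2.1.isClosed.mem_of_tendsto
      ((happ hlH tendsto_const_nhds).add hlp) (Eventually.of_forall fun n => hin (φ n) k hk)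
  have hout' : ∀ y ∈ unitSquare, ∃ k ∈ K, y = r • H' k + W' := by
    intro y hy
    choose k hk hky using fun n => hout (φ n) y hy
    obtain ⟨k', hk', ψ, hψ, hlk⟩ := hK.2.1.tendsto_subseq hk
    refine ⟨k', hk', tendsto_nhds_unique (f := fun _ : ℕ => y) (l := atTop) tendsto_const_nhds ?_⟩
    have := ((hlt'.comp hψ.tendsto_atTop).smul
      (happ (hlH.comp hψ.tendsto_atTop) hlk)).add (hlW.comp hψ.tendsto_atTop)
    refine this.congr fun n => ?_
    exact (hky (ψ n)).symm
  -- the limit map is onto, since differences of points of the square are in its range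
  have hsurj : Function.Surjective H'.toLinearMap := by
    have h1 : ∀ y ∈ unitSquare, y ∈ LinearMap.range H'.toLinearMap := by
      intro y hy
      obtain ⟨k, hk, e⟩ := hout' y hy
      obtain ⟨l, hl, e'⟩ := hout' 0 (by simp [unitSquare])
      refine ⟨r • (k - l), ?_⟩
      have : H' (r • (k - l)) = y := by
        rw [map_smul, map_sub]
        linear_combination (norm := module) e' - e
      exact this
    intro x
    have h2 : x = x 0 • !₂[1, 0] + x 1 • !₂[0, 1] := by
      ext i; fin_cases i <;> simp
    rw [h2]
    exact Submodule.add_mem _ (Submodule.smul_mem _ _ (h1 _ (by simp [unitSquare])))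
      (Submodule.smul_mem _ _ (h1 _ (by simp [unitSquare])))
  let h : Plane ≃ₗ[ℝ] Plane := LinearEquiv.ofBijective H'.toLinearMap
    ⟨LinearMap.injective_iff_surjective.mpr hsurj, hsurj⟩
  have hh : ∀ x, h x = H' x := fun x => rfl
  refine ⟨h, p', h.symm (W' - p'), fun k hk => hin' k hk, fun y hy => ?_⟩
  obtain ⟨k, hk, e⟩ := hout' y hy
  refine ⟨k, hk, ?_⟩
  rw [map_add, map_smul, LinearEquiv.apply_symm_apply, hh, e]
  abel

/-! ### Contact of a body with the square -/

theorem exists_pos_add_smul_mem {U : Set Plane} (hU : IsOpen U) {q : Plane} (hq : q ∈ U)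
    (d : Plane) : ∃ ε : ℝ, 0 < ε ∧ q + ε • d ∈ U := by
  have hcont : Continuous fun ε : ℝ => q + ε • d := by fun_prop
  have hmem : (fun ε : ℝ => q + ε • d) ⁻¹' U ∈ 𝓝 (0 : ℝ) :=
    (hU.preimage hcont).mem_nhds (by simpa using hq)
  obtain ⟨δ, hδ, hball⟩ := Metric.mem_nhds_iff.mp hmem
  refine ⟨δ / 2, by positivity, hball ?_⟩
  rw [Metric.mem_ball, dist_zero_right, Real.norm_of_nonneg (by positivity)]
  linarith

/-- A compact part of a convex set each point of which enters the interior when moved a little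
along a continuous vector field does so uniformly. -/
theorem IsCompact.exists_uniform_shift {X M : Set Plane} {D : Plane → Plane} (hX : IsCompact X)
    (hM : Convex ℝ M) (hXM : X ⊆ M) (hD : Continuous D)
    (h : ∀ p ∈ X, ∃ ε : ℝ, 0 < ε ∧ p + ε • D p ∈ interior M) :
    ∃ ε₀ : ℝ, 0 < ε₀ ∧ ∀ ε, 0 < ε → ε ≤ ε₀ → ∀ p ∈ X, p + ε • D p ∈ interior M := by
  have hmono : ∀ p ∈ X, ∀ ε ε' : ℝ, 0 < ε' → ε' ≤ ε → p + ε • D p ∈ interior M →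
      p + ε' • D p ∈ interior M := by
    intro p hp ε ε' h0 hle hε
    have hε0 : 0 < ε := h0.trans_le hle
    have := hM.combo_self_interior_mem_interior (hXM hp) hε (a := 1 - ε' / ε) (b := ε' / ε)
      (by rw [sub_nonneg, div_le_one hε0]; exact hle) (by positivity) (by ring)
    convert this using 1
    have e : ε' / ε * ε = ε' := div_mul_cancel₀ _ hε0.ne'
    linear_combination (norm := module) (-e) • D p
  let U : {ε : ℝ // 0 < ε} → Set Plane := fun ε => {p | p + ε.1 • D p ∈ interior M}
  have hU : ∀ ε, IsOpen (U ε) := fun ε => isOpen_interior.preimage (by fun_prop)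
  obtain ⟨t, ht⟩ := hX.elim_finite_subcover U hU fun p hp => by
    obtain ⟨ε, hε, h'⟩ := h p hp
    exact Set.mem_iUnion.mpr ⟨⟨ε, hε⟩, h'⟩
  obtain ⟨ε₀, h0, hle⟩ : ∃ ε₀ : ℝ, 0 < ε₀ ∧ ∀ ε ∈ t, ε₀ ≤ ε.1 := by
    clear ht
    induction t using Finset.induction_on with
    | empty => exact ⟨1, one_pos, by simp⟩
    | insert a t _ ih =>
      obtain ⟨ε₀, h0, hle⟩ := ih
      refine ⟨min a.1 ε₀, lt_min a.2 h0, fun ε hε => ?_⟩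
      rcases Finset.mem_insert.mp hε with rfl | hε
      · exact min_le_left _ _
      · exact (min_le_right _ _).trans (hle ε hε)
  refine ⟨ε₀, h0, fun ε hε hεle p hp => ?_⟩
  obtain ⟨ε', hε', hp'⟩ := Set.mem_iUnion₂.mp (ht hp)
  exact hmono p hp ε'.1 ε hε (hεle.trans (hle _ hε')) hp'

/-- The body `B` lies in the square, and the square lies in the homothet `c - r B` of the reflected
body, where `r > 1` is the least possible ratio. -/
structure OptimalSquarePosition (B : Set Plane) (r : ℝ) (c : Plane) : Prop where
  convex : Convex ℝ B
  isCompact : IsCompact B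
  one_lt : 1 < r
  subset_square : B ⊆ unitSquare
  square_subset : ∀ y ∈ unitSquare, ∃ k ∈ B, y = -(r • k) + c
  minimal : ∀ t, 1 < t → IsAsymmetryBound B t → r ≤ t

namespace OptimalSquarePosition

variable {B : Set Plane} {r : ℝ} {c : Plane}

/-- The homothet `c - r B` of the reflected body. -/
def reflected (B : Set Plane) (r : ℝ) (c : Plane) : Set Plane := {x | ∃ k ∈ B, x = -(r • k) + c}

theorem convex_reflected (h : OptimalSquarePosition B r c) : Convex ℝ (reflected B r c) := by
  rintro _ ⟨k, hk, rfl⟩ _ ⟨l, hl, rfl⟩ a b ha hb hab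
  refine ⟨a • k + b • l, h.convex hk hl ha hb hab, ?_⟩
  linear_combination (norm := module) hab • c

theorem square_subset_reflected (h : OptimalSquarePosition B r c) :
    unitSquare ⊆ reflected B r c := h.square_subset

theorem openSquare_subset (h : OptimalSquarePosition B r c) {x : Plane} (hx : ∀ i, |x i| < 1) :
    x ∈ interior (reflected B r c) := by
  refine mem_interior.mpr ⟨{x : Plane | |x 0| < 1 ∧ |x 1| < 1},
    fun y hy => h.square_subset_reflected ⟨hy.1.le, hy.2.le⟩, ?_, hx 0, hx 1⟩
  exact IsOpen.and (isOpen_lt (by fun_prop) (by fun_prop))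
    (isOpen_lt (by fun_prop) (by fun_prop))

theorem zero_mem_interior (h : OptimalSquarePosition B r c) :
    (0 : Plane) ∈ interior (reflected B r c) :=
  h.openSquare_subset (by simp)

theorem subset_closure_interior (h : OptimalSquarePosition B r c) :
    reflected B r c ⊆ closure (interior (reflected B r c)) := by
  rw [h.convex_reflected.closure_interior_eq_closure_of_nonempty_interior ⟨0, h.zero_mem_interior⟩]
  exact subset_closure

/-- A weak linear inequality on the interior extends to the whole set. -/
theorem le_of_forall_interior (h : OptimalSquarePosition B r c) {f : Plane →L[ℝ] ℝ} {u : ℝ}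
    (hf : ∀ x ∈ interior (reflected B r c), f x ≤ u) : ∀ x ∈ reflected B r c, f x ≤ u := by
  intro x hx
  have hcl : IsClosed {x | f x ≤ u} := isClosed_le f.continuous continuous_const
  exact closure_minimal hf hcl (h.subset_closure_interior hx)

/-- No translate of `B` fits into the interior of the reflected homothet. In pointwise form: every
direction is obstructed at a point of contact. -/
theorem exists_shift_notMem (h : OptimalSquarePosition B r c) (d : Plane) :
    ∃ p ∈ B, p ∉ interior (reflected B r c) ∧
      ∀ ε : ℝ, 0 < ε → p + ε • d ∉ interior (reflected B r c) := by
  by_contra! hcon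
  set M := reflected B r c with hM
  have hMc := h.convex_reflected
  have hBM : B ⊆ M := h.subset_square.trans h.square_subset_reflected
  obtain ⟨ε, hε, hshift⟩ := h.isCompact.exists_uniform_shift hMc hBM
    (D := fun _ => d) continuous_const fun p hp => by
      by_cases hpi : p ∈ interior M
      · exact exists_pos_add_smul_mem isOpen_interior hpi d
      · exact hcon p hp hpi
  have hX : IsCompact ((fun p => p + ε • d) '' B) := h.isCompact.image (by fun_prop)
  have hXi : (fun p => p + ε • d) '' B ⊆ interior M := by
    rintro _ ⟨p, hp, rfl⟩
    exact hshift ε hε le_rfl p hp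
  -- a translate of `B` in the interior can be blown up, which contradicts minimality of `r`
  obtain ⟨η, hη, hblow⟩ := hX.exists_uniform_shift hMc (hXi.trans interior_subset)
    (D := fun p => p) continuous_id fun q hq =>
      exists_pos_add_smul_mem isOpen_interior (hXi hq) q
  have hr := h.one_lt
  set θ := min η ((r - 1) / 2) with hθ
  have hθ0 : 0 < θ := lt_min hη (by linarith)
  have hθr : θ ≤ (r - 1) / 2 := min_le_right _ _
  have hθ1 : 0 < 1 + θ := by linarith
  have hmin := h.minimal (r / (1 + θ)) (by rw [lt_div_iff₀ hθ1]; linarith)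
    ⟨by positivity, (1 + θ)⁻¹ • c - ε • d, fun p hp => by
      obtain ⟨k, hk, e⟩ := interior_subset (hblow θ hθ0 (min_le_left _ _) _ ⟨p, hp, rfl⟩)
      refine ⟨k, hk, ?_⟩
      have h1 : (1 + θ)⁻¹ * (1 + θ) = 1 := inv_mul_cancel₀ hθ1.ne'
      have h2 : p + ε • d = (1 + θ)⁻¹ • (-(r • k) + c) := by
        rw [← e]
        linear_combination (norm := module) (-h1) • (p + ε • d)
      rw [div_eq_inv_mul]
      linear_combination (norm := module) h2⟩
  rw [le_div_iff₀ hθ1] at hmin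
  nlinarith

/-- If `B` reaches the boundary of the reflected homothet in the relative interior of a side of the
square, then the line through that side supports the homothet. -/
theorem le_one_of_contact (h : OptimalSquarePosition B r c) {p : Plane}
    (hpi : p ∉ interior (reflected B r c)) {i j : Fin 2} (hij : i ≠ j) (hi : |p i| = 1)
    (hj : |p j| < 1) : ∀ m ∈ reflected B r c, p i * m i ≤ 1 := by
  obtain ⟨f, hf⟩ := geometric_hahn_banach_open_point h.convex_reflected.interior isOpen_interior hpi
  have hf' := h.le_of_forall_interior fun x hx => (hf x hx).le
  have hrep : ∀ x : Plane, f x = x i * f (EuclideanSpace.single i 1) +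
      x j * f (EuclideanSpace.single j 1) := by
    intro x
    have : x = x i • EuclideanSpace.single i 1 + x j • EuclideanSpace.single j 1 := by
      ext k
      fin_cases i <;> fin_cases j <;> fin_cases k <;> simp at hij ⊢
    conv_lhs => rw [this]
    simp
  have hsq : ∀ δ : ℝ, |δ| ≤ 1 - |p j| → p + δ • EuclideanSpace.single j 1 ∈ unitSquare := by
    intro δ hδ
    rw [mem_unitSquare]
    intro k
    by_cases hk : k = j
    · subst hk
      have := abs_add_le (p k) δ
      simp
      linarith
    · obtain rfl : k = i := by omega
      simp [hk, hi]
  have hj0 : f (EuclideanSpace.single j 1) = 0 := by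
    have hpos : 0 < 1 - |p j| := by linarith
    have h1 := hf' _ (h.square_subset_reflected (hsq (1 - |p j|) (abs_of_pos hpos).le))
    have h2 := hf' _ (h.square_subset_reflected (hsq (-(1 - |p j|))
      (by rw [abs_neg]; exact (abs_of_pos hpos).le)))
    rw [map_add, map_smul, smul_eq_mul] at h1 h2
    nlinarith
  have h0 := hf 0 h.zero_mem_interior
  rw [map_zero, hrep p, hj0, mul_zero, add_zero] at h0
  have hpp : p i * p i = 1 := by rw [← abs_mul_abs_self, hi, one_mul]
  intro m hm
  have hm' := hf' m hm
  rw [hrep m, hrep p, hj0, mul_zero, mul_zero, add_zero, add_zero] at hm'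
  set a := f (EuclideanSpace.single i 1)
  by_contra! hlt
  nlinarith

/-- A point of `B` on the boundary of the reflected homothet lies on the boundary of the square. -/
theorem exists_abs_eq_one (h : OptimalSquarePosition B r c) {p : Plane} (hp : p ∈ B)
    (hpi : p ∉ interior (reflected B r c)) : ∃ i, |p i| = 1 := by
  by_contra! hcon
  exact hpi (h.openSquare_subset fun i =>
    lt_of_le_of_ne (mem_unitSquare.mp (h.subset_square hp) i) (hcon i))

theorem reflected_mem {p : Plane} (hp : p ∈ B) : -(r • p) + c ∈ reflected B r c := ⟨p, hp, rfl⟩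

/-- The body contains a vertex of the square: otherwise it meets at most one of any two opposite
sides in points that block a translation, so it could be moved away from the blocking sides. -/
theorem exists_vertex (h : OptimalSquarePosition B r c) : ∃ p ∈ B, ∀ i, |p i| = 1 := by
  classical
  by_contra! hcon
  let T : Fin 2 → ℝ → Prop := fun i σ =>
    (∃ p ∈ B, p i = σ) ∧ ∀ m ∈ reflected B r c, σ * m i ≤ 1
  have hT : ∀ i, ¬ (T i 1 ∧ T i (-1)) := by
    rintro i ⟨⟨⟨p, hp, hpi⟩, h1⟩, ⟨⟨q, hq, hqi⟩, h2⟩⟩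
    have e1 := h2 _ (reflected_mem hp)
    have e2 := h1 _ (reflected_mem hq)
    simp [hpi, hqi] at e1 e2
    have := h.one_lt
    linarith
  let d : Plane := WithLp.toLp 2 fun i => if T i 1 then (-1 : ℝ) else 1
  have hd : ∀ i, d i = if T i 1 then (-1 : ℝ) else 1 := fun i => rfl
  have hd1 : ∀ i, |d i| = 1 := fun i => by rw [hd]; split_ifs <;> simp
  obtain ⟨p, hp, hpi, hshift⟩ := h.exists_shift_notMem d
  obtain ⟨i, hi⟩ := h.exists_abs_eq_one hp hpi
  obtain ⟨j, hj⟩ := hcon p hp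
  have hij : i ≠ j := fun hij => hj (hij ▸ hi)
  have hj1 : |p j| < 1 := lt_of_le_of_ne (mem_unitSquare.mp (h.subset_square hp) j) hj
  have hblock := h.le_one_of_contact hpi hij hi hj1
  have hTi : T i (p i) := ⟨⟨p, hp, rfl⟩, hblock⟩
  have hpd : p i * d i = -1 := by
    rw [hd]
    rcases eq_or_eq_neg_of_abs_eq hi with e | e
    · rw [e] at hTi
      rw [if_pos hTi, e]; norm_num
    · rw [e] at hTi
      rw [if_neg fun h1 => hT i ⟨h1, hTi⟩, e]; norm_num
  have hε : 0 < (1 - |p j|) / 2 := by linarith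
  refine hshift ((1 - |p j|) / 2) hε (h.openSquare_subset fun k => ?_)
  simp only [PiLp.add_apply, PiLp.smul_apply, smul_eq_mul]
  have hj0 := abs_nonneg (p j)
  by_cases hk : k = j
  · subst hk
    have h1 := abs_add_le (p k) ((1 - |p k|) / 2 * d k)
    rw [abs_mul, hd1, abs_of_pos hε] at h1
    linarith
  · obtain rfl : k = i := by omega
    rcases eq_or_eq_neg_of_abs_eq hi with e | e
    · rw [e] at hpd ⊢
      obtain e' : d k = -1 := by linarith
      rw [e', abs_lt]; constructor <;> linarith
    · rw [e] at hpd ⊢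
      obtain e' : d k = 1 := by linarith
      rw [e', abs_lt]; constructor <;> linarith

/-- Either the body contains two neighboring vertices of the square, or one side of the square lies
on the boundary of the reflected homothet. Otherwise the two bodies touch in two opposite vertices
of the square at most; separating the two cones of directions that lead into the interior there
bounds a width of the homothet by the same width of the body. -/
theorem exists_adjacent_or_side (h : OptimalSquarePosition B r c) :
    (∃ p ∈ B, ∃ q ∈ B, p ≠ q ∧ ∃ i, |p i| = 1 ∧ p i = q i) ∨
      ∃ (i : Fin 2) (σ : ℝ), |σ| = 1 ∧ ∀ m ∈ reflected B r c, σ * m i ≤ 1 := by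
  by_contra! hcon
  obtain ⟨hadj, hside⟩ := hcon
  set M := reflected B r c with hM
  have hMc := h.convex_reflected
  have hvert : ∀ p ∈ B, p ∉ interior M → ∀ i, |p i| = 1 := by
    intro p hp hpi
    by_contra! hne
    obtain ⟨j, hj⟩ := hne
    obtain ⟨i, hi⟩ := h.exists_abs_eq_one hp hpi
    have hij : i ≠ j := fun hij => hj (hij ▸ hi)
    obtain ⟨m, hm, hlt⟩ := hside i (p i) hi
    exact absurd (h.le_one_of_contact hpi hij hi
      (lt_of_le_of_ne (mem_unitSquare.mp (h.subset_square hp) j) hj) m hm) (not_le.mpr hlt)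
  have hopp : ∀ p ∈ B, p ∉ interior M → ∀ q ∈ B, q ∉ interior M → q = p ∨ q = -p := by
    intro p hp hpi q hq hqi
    by_cases hpq : p = q
    · exact Or.inl hpq.symm
    · right
      ext i
      have h1 := hadj p hp q hq hpq i (hvert p hp hpi i)
      have h2 : |q i| = |p i| := by rw [hvert p hp hpi, hvert q hq hqi]
      exact (abs_eq_abs.mp h2).resolve_left fun e => h1 e.symm
  obtain ⟨v, hv, hvi, -⟩ := h.exists_shift_notMem 0
  have hvabs := hvert v hv hvi
  have hhalf : v + (1 / 2 : ℝ) • (-v) ∈ interior M := by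
    refine h.openSquare_subset fun i => ?_
    have e : (v + (1 / 2 : ℝ) • (-v)) i = 1 / 2 * v i := by simp; ring
    rw [e, abs_mul, hvabs i]
    norm_num
  by_cases hvB : -v ∈ B
  · by_cases hdisj : Disjoint {x | v + x ∈ interior M} {x | -v + x ∈ interior M}
    · have hconv : ∀ w : Plane, Convex ℝ {x | w + x ∈ interior M} := fun w =>
        hMc.interior.translate_preimage_right w
      have hopen : ∀ w : Plane, IsOpen {x | w + x ∈ interior M} := fun w =>
        isOpen_interior.preimage (by fun_prop)
      obtain ⟨f, u, hfu, huf⟩ := geometric_hahn_banach_open_open (hconv v) (hopen v) (hconv (-v))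
        (hopen (-v)) hdisj
      have e1 : ∀ m ∈ interior M, f m ≤ u + f v := fun m hm => by
        have := hfu (m - v) (by
          rw [Set.mem_ofPred_eq, add_sub_cancel]; exact hm)
        rw [map_sub] at this
        linarith
      have e2 : ∀ m ∈ interior M, (-f) m ≤ f v - u := fun m hm => by
        have := huf (m + v) (by
          rw [Set.mem_ofPred_eq, add_comm m v, neg_add_cancel_left]; exact hm)
        rw [map_add] at this
        rw [neg_apply]
        linarith
      have g1 := h.le_of_forall_interior e1 _ (reflected_mem hvB)
      have g2 := h.le_of_forall_interior e2 _ (reflected_mem hv)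
      have z1 := hfu (-v) (by
        rw [Set.mem_ofPred_eq, add_neg_cancel]; exact h.zero_mem_interior)
      have z2 := huf v (by
        rw [Set.mem_ofPred_eq, neg_add_cancel]; exact h.zero_mem_interior)
      simp only [map_add, map_neg, map_smul, smul_eq_mul, neg_apply] at g1 g2 z1
      nlinarith [h.one_lt]
    · obtain ⟨x, hx1, hx2⟩ := Set.not_disjoint_iff.mp hdisj
      obtain ⟨p, hp, hpi, hshift⟩ := h.exists_shift_notMem x
      have := hshift 1 one_pos
      rw [one_smul] at this
      rcases hopp v hv hvi p hp hpi with rfl | rfl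
      · exact this hx1
      · exact this hx2
  · obtain ⟨p, hp, hpi, hshift⟩ := h.exists_shift_notMem (-v)
    rcases hopp v hv hvi p hp hpi with rfl | rfl
    · exact hshift (1 / 2) (by norm_num) hhalf
    · exact hvB hp

end OptimalSquarePosition

/-! ### Smoothness and strict convexity -/

theorem notMem_interior_of_isMax {K : Set Plane} {f : Plane →ₗ[ℝ] ℝ} {x₀ k : Plane}
    (hf : f x₀ ≠ 0) (hk : ∀ x ∈ K, f x ≤ f k) : k ∉ interior K := by
  intro hi
  obtain ⟨ε, hε, hmem⟩ := exists_pos_add_smul_mem isOpen_interior hi (f x₀ • x₀)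
  have h1 := hk _ (interior_subset hmem)
  rw [map_add, map_smul, map_smul, smul_eq_mul, smul_eq_mul] at h1
  have : 0 < ε * (f x₀ * f x₀) := mul_pos hε (mul_self_pos.mpr hf)
  linarith

theorem not_strictConvex_of_isMax {K : Set Plane} {f : Plane →ₗ[ℝ] ℝ} {x₀ k l : Plane}
    (hf : f x₀ ≠ 0) (hk : k ∈ K) (hl : l ∈ K) (hne : k ≠ l) (hkl : f k = f l)
    (hmax : ∀ x ∈ K, f x ≤ f k) : ¬ StrictConvex ℝ K := by
  intro hK
  have := hK hk hl hne (a := 1 / 2) (b := 1 / 2) (by norm_num) (by norm_num) (by norm_num)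
  refine notMem_interior_of_isMax hf (fun x hx => ?_) this
  have e : f ((1 / 2 : ℝ) • k + (1 / 2 : ℝ) • l) = f k := by
    rw [map_add, map_smul, map_smul, ← hkl, smul_eq_mul]; ring
  rw [e]
  exact hmax x hx

/-- The level line of a functional that is maximal at `k` is a supporting line. -/
theorem isSupportingLineAt_of_isMax {K : Set Plane} {f : Plane →ₗ[ℝ] ℝ} {x₀ k : Plane}
    (hf : f x₀ ≠ 0) (hmax : ∀ x ∈ K, f x ≤ f k) :
    IsSupportingLineAt K k {y | f y = f k} := by
  set v := (InnerProductSpace.toDual ℝ Plane).symm (LinearMap.toContinuousLinearMap f) with hv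
  have hvf : ∀ x, inner ℝ v x = f x := fun x => by
    rw [hv, InnerProductSpace.toDual_symm_apply]; rfl
  refine ⟨v, fun h0 => hf ?_, ?_, fun y hy => ?_⟩
  · rw [← hvf, h0, inner_zero_left]
  · simp only [hvf]
  · rw [hvf, hvf]; exact hmax y hy

theorem not_isSmoothBody_of_isMax {K : Set Plane} {f g : Plane →ₗ[ℝ] ℝ} {k x y : Plane}
    (hk : k ∈ K) (hf : ∀ z ∈ K, f z ≤ f k) (hg : ∀ z ∈ K, g z ≤ g k) (hfx : f x ≠ 0)
    (hgx : g x = 0) (hgy : g y ≠ 0) : ¬ IsSmoothBody K := by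
  intro hK
  have hfr : k ∈ frontier K := ⟨subset_closure hk, notMem_interior_of_isMax hfx hf⟩
  have e := (hK k hfr).unique (isSupportingLineAt_of_isMax hfx hf)
    (isSupportingLineAt_of_isMax hgy hg)
  have h1 : k + x ∈ {y | g y = g k} := by
    rw [Set.mem_ofPred_eq, map_add, hgx, add_zero]
  rw [← e, Set.mem_ofPred_eq, map_add] at h1
  exact hfx (by linarith)

/-- Contact with the square at the optimal ratio forces a corner and a segment on the boundary. -/
theorem EquidistantToSymmetric.not_smooth_not_strictConvex {K : Set Plane} {r : ℝ}
    (hE : EquidistantToSymmetric K r) (hK : IsConvexBody K) :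
    ¬ IsSmoothBody K ∧ ¬ StrictConvex ℝ K := by
  have hr : 1 < r := by
    refine lt_of_lt_of_le ?_ (hE.sqrt_le hK)
    rw [Real.lt_sqrt (by norm_num)]
    norm_num
  obtain ⟨h, p, w, hin, hout⟩ := hE.hasAffineSandwich_unitSquare hK
  set B : Set Plane := (fun k => h k + p) '' K with hB
  have hcont : Continuous fun k => h k + p :=
    (LinearMap.continuous_of_finiteDimensional h.toLinearMap).add continuous_const
  have hpos : OptimalSquarePosition B r (r • p - h w - p) := by
    refine ⟨?_, hK.2.1.image hcont, hr, ?_, fun y hy => ?_, fun t ht hb => ?_⟩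
    · rintro _ ⟨k, hk, rfl⟩ _ ⟨l, hl, rfl⟩ a b ha hb hab
      refine ⟨a • k + b • l, hK.1 hk hl ha hb hab, ?_⟩
      simp only [map_add, map_smul]
      linear_combination (norm := module) (-hab) • p
    · rintro _ ⟨k, hk, rfl⟩
      exact hin k hk
    · obtain ⟨k, hk, e⟩ := hout _ (neg_mem_unitSquare hy)
      refine ⟨_, ⟨k, hk, rfl⟩, ?_⟩
      rw [map_add, map_smul] at e
      linear_combination (norm := module) -e
    · obtain ⟨ht0, c, hc⟩ := hb
      refine hE.le_of_isAsymmetryBound hK ht ⟨ht0, h.symm (c - t • p - p), fun x hx => ?_⟩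
      obtain ⟨_, ⟨y, hy, rfl⟩, e⟩ := hc _ ⟨x, hx, rfl⟩
      refine ⟨y, hy, h.injective ?_⟩
      rw [map_add, map_neg, map_smul, LinearEquiv.apply_symm_apply]
      linear_combination (norm := module) e
  -- the functional on `K` that corresponds to a signed coordinate on the square
  let f : Fin 2 → ℝ → Plane →ₗ[ℝ] ℝ := fun i σ =>
    σ • ((EuclideanSpace.proj i : Plane →L[ℝ] ℝ).toLinearMap ∘ₗ h.toLinearMap)
  have hf : ∀ i σ x, f i σ x = σ * (h x) i := fun i σ x => rfl
  have hf1 : ∀ i j σ, f i σ (h.symm (EuclideanSpace.single j 1)) = if i = j then σ else 0 := by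
    intro i j σ
    rw [hf, LinearEquiv.apply_symm_apply]
    simp [PiLp.single_apply]
  have hfne : ∀ i σ, |σ| = 1 → f i σ (h.symm (EuclideanSpace.single i 1)) ≠ 0 := by
    intro i σ hσ
    rw [hf1, if_pos rfl]
    rintro rfl
    simp at hσ
  have hfmax : ∀ i, ∀ k ∈ K, |(h k + p) i| = 1 → ∀ z ∈ K,
      f i ((h k + p) i) z ≤ f i ((h k + p) i) k := by
    intro i k hk habs z hz
    have h1 := abs_le.mp (mem_unitSquare.mp (hin z hz) i)
    rw [hf, hf]
    rcases eq_or_eq_neg_of_abs_eq habs with e | e <;> rw [e] <;>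
      rw [PiLp.add_apply] at e h1 <;> linarith
  constructor
  · obtain ⟨_, ⟨k, hk, rfl⟩, habs⟩ := hpos.exists_vertex
    refine not_isSmoothBody_of_isMax hk (hfmax 0 k hk (habs 0)) (hfmax 1 k hk (habs 1))
      (hfne 0 _ (habs 0)) ?_ (hfne 1 _ (habs 1))
    rw [hf1, if_neg (by decide)]
  · rcases hpos.exists_adjacent_or_side with
      ⟨_, ⟨k, hk, rfl⟩, _, ⟨l, hl, rfl⟩, hne, i, habs, heq⟩ | ⟨i, σ, hσ, hside⟩
    · refine not_strictConvex_of_isMax (hfne i _ habs) hk hl (fun e => hne (by rw [e])) ?_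
        (hfmax i k hk habs)
      have : (h k) i = (h l) i := by
        have := heq
        simp only [PiLp.add_apply] at this
        linarith
      rw [hf, hf, this]
    · -- the end points of the side come from two points of `K` with the same extremal coordinate
      have hσσ : σ * σ = 1 := by rw [← abs_mul_abs_self, hσ, one_mul]
      have hpt : ∀ τ : ℝ, |τ| = 1 → ∃ k ∈ K, ∀ j, (if j = i then σ else τ) =
          -(r * (h k + p) j) + (r • p - h w - p) j := by
        intro τ hτ
        obtain ⟨_, ⟨k, hk, rfl⟩, e⟩ := hpos.square_subset
          (WithLp.toLp 2 fun j => if j = i then σ else τ) (by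
            rw [mem_unitSquare]
            intro j
            by_cases hj : j = i <;> simp [hj, hσ, hτ])
        refine ⟨k, hk, fun j => ?_⟩
        exact congrArg (fun x : Plane => x j) e
      obtain ⟨k, hk, ek⟩ := hpt 1 (by simp)
      obtain ⟨l, hl, el⟩ := hpt (-1) (by simp)
      have eki := ek i
      have eli := el i
      rw [if_pos rfl, PiLp.add_apply] at eki eli
      have hr0 : 0 < r := by linarith
      refine not_strictConvex_of_isMax (f := f i (-σ))
        (hfne i _ (by rw [abs_neg]; exact hσ)) hk hl ?_ ?_ fun z hz => ?_
      · rintro rfl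
        obtain ⟨j, hj⟩ : ∃ j, j ≠ i := exists_ne i
        have h1 := ek j
        have h2 := el j
        rw [if_neg hj] at h1 h2
        linarith
      · have : r * (h k) i = r * (h l) i := by linarith
        rw [hf, hf, mul_left_cancel₀ hr0.ne' this]
      · have hz' := hside _ (OptimalSquarePosition.reflected_mem (B := B) (r := r)
          (c := r • p - h w - p) ⟨z, hz, rfl⟩)
        rw [PiLp.add_apply, PiLp.neg_apply, PiLp.smul_apply, smul_eq_mul, PiLp.add_apply] at hz'
        rw [hf, hf]
        have h3 : σ * σ = σ * (-(r * ((h k) i + p i)) + (r • p - h w - p) i) := by rw [← eki]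
        rw [hσσ] at h3
        have h4 : r * (-σ * (h z) i) ≤ r * (-σ * (h k) i) := by linarith
        exact le_of_mul_le_mul_left h4 hr0

theorem theorem4p3 :
    (∀ r : ℝ, 7 / 4 ≤ r → r < 2 →
      ∃ K : Set Plane, IsConvexPentagon K ∧ asymmetryConst K = r ∧ EquidistantToSymmetric K r) ∧
    (∃ K : Set Plane, IsTriangle K ∧ asymmetryConst K = 2 ∧ EquidistantToSymmetric K 2) ∧
    (∀ r : ℝ, 7 / 4 < r → r < 2 →
      ∃ F : Set (Set Plane), Cardinal.mk F = Cardinal.continuum ∧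
        (∀ K ∈ F, IsConvexPentagon K ∧ asymmetryConst K = r ∧ EquidistantToSymmetric K r) ∧
        F.Pairwise (fun K K' => ¬ AffinelyEquivalent K K')) ∧
    (∀ (K : Set Plane) (r : ℝ), IsConvexBody K → EquidistantToSymmetric K r →
      Real.sqrt (3 / 2) ≤ r ∧ ¬ IsSmoothBody K ∧ ¬ StrictConvex ℝ K) :=
  ⟨fun _ h1 h2 => exists_equidistant_pentagon h1 h2, exists_equidistant_triangle,
    fun _ h1 h2 => exists_continuum_equidistant_pentagons h1 h2,
    fun _ _ hK hE => ⟨hE.sqrt_le hK, hE.not_smooth_not_strictConvex hK⟩⟩
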